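/- Let $\mathbb K\in\{\mathbb R,\mathbb C\}$, let $A$ be a Banach algebra over $\mathbb K$ (not necessarily unital), $G$ a locally compact Hausdorff group with a fixed left Haar measure $\mu$ (written $dr$), and $\alpha\colon G\to\mathrm{Aut}(A)$ a strongly continuous representation of $G$ on $A$ by bounded algebra automorphisms which is uniformly bounded: $\|\alpha_s\|\le C_\alpha$ for some $C_\alpha\ge 0$ and all $s\in G$. Suppose that $A$ has a bounded two-sided approximate identity. Let $\omega\colon G\to[0,\infty)$ be a weight, i.e. a non-zero Borel measurable function with $\omega(rs)\le\omega(r)\omega(s)$ for all $r,s\in G$. Let $L^1(G,A,\omega)$ be the completion of the space $C_c(G,A)$ of compactly supported continuous functions $G\to A$ with respect to the norm $\|f\|_{1,\omega}=\int_G\|f(s)\|\,\omega(s)\,ds$. The generalized Beurling algebra $L^1(G,A,\omega;\alpha)$ is this Banach space with the continuous multiplication that extends the twisted convolution $$[f*g](s)=\int_G f(r)\,\alpha_r(g(r^{-1}s))\,dr\qquad(f,g\in C_c(G,A),\ s\in G).$$ Let $X$ be a Banach space over $\mathbb K$ and $B(X)$ the algebra of bounded operators on $X$. A continuous covariant representation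 of $(A,G,\alpha)$ on $X$ is a pair $(\pi,U)$ of a bounded algebra representation $\pi\colon A\to B(X)$ and a strongly continuous group representation $U\colon G\to B(X)$ (with $U_e=\mathrm{id}_X$) such that $\pi(\alpha_s(a))=U_s\pi(a)U_s^{-1}$ for all $a\in A$, $s\in G$; it is non-degenerate if the span of $\pi(A)X$ is dense in $X$. A bounded representation of $L^1(G,A,\omega;\alpha)$ on $X$ is a bounded linear multiplicative map $T\colon L^1(G,A,\omega;\alpha)\to B(X)$; it is non-degenerate if the span of $T(L^1(G,A,\omega;\alpha))X$ is dense in $X$. Then the following two maps are well defined and are mutually inverse bijections between the non-degenerate continuous covariant representations $(\pi,U)$ of $(A,G,\alpha)$ on $X$ for which there is a constant $C_U\ge 0$ with $\|U_r\|\le C_U\,\omega(r)$ for all $r\in G$, and the non-degenerate bounded representations $T$ of $L^1(G,A,\omega;\alpha)$ on $X$: * $(\pi,U)\mapsto T^{(\pi,U)}$, the bounded representation determined by $T^{(\pi,U)}(f)x=\int_G\pi(f(r))U_r x\,dr$ for $f\in C_c(G,A)$ and $x\in X$; * $T\mapsto(\pi^T,U^T)$, where $$\pi^T(a)=\text{SOT-}\lim_{(V,i)}T(z_V\otimes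 au_i)\quad(a\in A),\qquad U^T_s=\text{SOT-}\lim_{(V,i)}T(z_V(s^{-1}\,\cdot)\otimes u_i)\quad(s\in G).$$ Here $(u_i)$ is any bounded left approximate identity of $A$, $\mathcal Z$ is any neighbourhood base of $e\in G$ all of whose elements are contained in a fixed compact subset of $G$, for every $V\in\mathcal Z$ the function $z_V\in C_c(G)$ is non-negative, vanishes outside $V$ and satisfies $\int_G z_V(r)\,dr=1$, $(z\otimes a)(r)=z(r)a$, and the pairs $(V,i)$ are directed by reverse inclusion in $V$ and by the order of the index set of $(u_i)$ in $i$. The limits exist in the strong operator topology and do not depend on the choices made. Furthermore, for every $\mathcal Z$ as above: 1. $\|T^{(\pi,U)}\|\le C_U\|\pi\|$ whenever $C_U\ge 0$ satisfies $\|U_r\|\le C_U\,\omega(r)$ for all $r\in G$; 2. $\|\pi^T\|\le\bigl(\inf_{V\in\mathcal Z}\sup_{r\in V}\omega(r)\bigr)\|T\|$; 3. if $A$ has a left approximate identity bounded by $M$, then $\|U^T_s\|\le M\bigl(\inf_{V\in\mathcal Z}\sup_{r\in V}\omega(r)\bigr)\|T\|\,\omega(s)$ for all $s\in G$. -/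

import Mathlib

open MeasureTheory Filter Topology UniformSpace
open scoped NNReal ENNReal CompactlySupported Pointwise

set_option linter.unusedSectionVars false

noncomputable section

/-! ### Weights -/

/-- A weight on `G`: a non-zero submultiplicative (Borel) measurable function `G → [0, ∞)`.
It need not be continuous, nor bounded below by `1`. -/
structure GroupWeight (G : Type*) [Group G] [MeasurableSpace G] where
  toFun : G → ℝ≥0
  measurable' : Measurable toFun
  submul' : ∀ r s : G, toFun (r * s) ≤ toFun r * toFun s
  ne_zero' : toFun ≠ 0

instance {G : Type*} [Group G] [MeasurableSpace G] :
    CoeFun (GroupWeight G) (fun _ => G → ℝ≥0) := ⟨GroupWeight.toFun⟩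

section LocallyBounded

variable {G : Type*} [Group G] [TopologicalSpace G] [IsTopologicalGroup G] [T2Space G]
  [LocallyCompactSpace G] [MeasurableSpace G] [BorelSpace G]

/-- A weight is bounded on a neighbourhood of the identity. -/
theorem GroupWeight.exists_nhds_one_bound (ω : GroupWeight G) :
    ∃ N ∈ 𝓝 (1 : G), ∃ C : ℝ≥0, ∀ r ∈ N, ω r ≤ C := by
  obtain ⟨K, hK, hK1⟩ := exists_compact_mem_nhds (1 : G)
  let μ : Measure G := Measure.haar
  let E : ℕ → Set G := fun n => K ∩ ({r | ω r ≤ n} ∩ {r | ω r⁻¹ ≤ n})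
  have hEm : ∀ n, MeasurableSet (E n) := fun n =>
    hK.isClosed.measurableSet.inter
      ((measurableSet_le ω.measurable' measurable_const).inter
        (measurableSet_le (ω.measurable'.comp measurable_inv) measurable_const))
  have hEU : (⋃ n, E n) = K := by
    apply Set.Subset.antisymm
    · exact Set.iUnion_subset fun n => Set.inter_subset_left
    · intro r hr
      obtain ⟨n, hn⟩ := exists_nat_ge (max (ω r) (ω r⁻¹))
      exact Set.mem_iUnion.2 ⟨n, hr, (le_max_left _ _).trans hn, (le_max_right _ _).trans hn⟩
  have hKpos : 0 < μ K := Measure.measure_pos_of_mem_nhds μ hK1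
  have : ∃ n, 0 < μ (E n) := by
    by_contra! h
    have h0 : μ (⋃ n, E n) = 0 := measure_iUnion_null fun n => le_antisymm (h n) bot_le
    rw [hEU] at h0
    exact hKpos.ne' h0
  obtain ⟨n, hn⟩ := this
  have hfin : μ (E n) ≠ ∞ :=
    ((measure_mono Set.inter_subset_left).trans_lt hK.measure_lt_top).ne
  refine ⟨E n / E n, Measure.div_mem_nhds_one_of_haar_pos_ne_top μ (E n) (hEm n) hn hfin,
    n * n, ?_⟩
  rintro _ ⟨x, hx, y, hy, rfl⟩
  calc ω (x / y) = ω (x * y⁻¹) := by rw [div_eq_mul_inv]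
    _ ≤ ω x * ω y⁻¹ := ω.submul' _ _
    _ ≤ n * n := mul_le_mul' hx.2.1 hy.2.2

/-- A weight is bounded on compact sets. -/
theorem GroupWeight.exists_bound_of_isCompact (ω : GroupWeight G) {K : Set G} (hK : IsCompact K) :
    ∃ C : ℝ≥0, ∀ r ∈ K, ω r ≤ C := by
  obtain ⟨N, hN, C, hC⟩ := ω.exists_nhds_one_bound
  refine hK.induction_on (p := fun S => ∃ C : ℝ≥0, ∀ r ∈ S, ω r ≤ C) ⟨0, by simp⟩ ?_ ?_ ?_
  · rintro s t hst ⟨D, hD⟩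
    exact ⟨D, fun r hr => hD r (hst hr)⟩
  · rintro s t ⟨D, hD⟩ ⟨D', hD'⟩
    refine ⟨max D D', ?_⟩
    rintro r (hr | hr)
    · exact (hD r hr).trans (le_max_left _ _)
    · exact (hD' r hr).trans (le_max_right _ _)
  · intro x _
    refine ⟨x • N, mem_nhdsWithin_of_mem_nhds ?_, ω x * C, ?_⟩
    · simpa using smul_mem_nhds_smul x hN
    · rintro _ ⟨y, hy, rfl⟩
      exact (ω.submul' x y).trans (mul_le_mul' le_rfl (hC y hy))

/-- The measure `ω dμ` is finite on compact sets. -/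
instance GroupWeight.isFiniteMeasureOnCompacts (ω : GroupWeight G) (μ : Measure G)
    [IsFiniteMeasureOnCompacts μ] :
    IsFiniteMeasureOnCompacts (μ.withDensity fun s => (ω s : ℝ≥0∞)) where
  lt_top_of_isCompact := by
    intro K hK
    obtain ⟨C, hC⟩ := ω.exists_bound_of_isCompact hK
    rw [withDensity_apply _ hK.isClosed.measurableSet]
    calc ∫⁻ s in K, (ω s : ℝ≥0∞) ∂μ ≤ ∫⁻ _ in K, (C : ℝ≥0∞) ∂μ :=
          setLIntegral_mono measurable_const fun r hr => by exact_mod_cast hC r hr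
      _ = C * μ K := by simp
      _ < ∞ := ENNReal.mul_lt_top ENNReal.coe_lt_top hK.measure_lt_top

end LocallyBounded

/-! ### The weighted space `L¹(G, A, ω)` -/

/-- The space `C_c(G, A)`, as a carrier of the weighted norm `f ↦ ∫ ‖f(s)‖ ω(s) dμ(s)`. -/
def WeightedCc {G : Type*} [Group G] [TopologicalSpace G] [MeasurableSpace G]
    (A : Type*) [NormedAddCommGroup A] (_ω : GroupWeight G) (_μ : Measure G) : Type _ :=
  C_c(G, A)

section WeightedSpace

variable {𝕜 : Type*} [RCLike 𝕜]
  {G : Type*} [Group G] [TopologicalSpace G] [IsTopologicalGroup G] [T2Space G]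
  [LocallyCompactSpace G] [MeasurableSpace G] [BorelSpace G]
  {A : Type*} [NormedAddCommGroup A] [NormedSpace 𝕜 A]
  (ω : GroupWeight G) (μ : Measure G) [IsFiniteMeasureOnCompacts μ]

instance : AddCommGroup (WeightedCc A ω μ) := inferInstanceAs (AddCommGroup C_c(G, A))

instance : Module 𝕜 (WeightedCc A ω μ) := inferInstanceAs (Module 𝕜 C_c(G, A))

instance : FunLike (WeightedCc A ω μ) G A := inferInstanceAs (FunLike C_c(G, A) G A)

instance : Norm (WeightedCc A ω μ) := ⟨fun f => ∫ s, ‖f s‖ * ω s ∂μ⟩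


theorem WeightedCc.norm_def (f : WeightedCc A ω μ) : ‖f‖ = ∫ s, ‖f s‖ * ω s ∂μ := rfl

theorem WeightedCc.norm_eq (f : WeightedCc A ω μ) :
    ‖f‖ = ∫ s, ‖f s‖ ∂(μ.withDensity fun s => (ω s : ℝ≥0∞)) := by
  rw [integral_withDensity_eq_integral_smul ω.measurable', WeightedCc.norm_def]
  congr 1 with s
  rw [NNReal.smul_def, smul_eq_mul, mul_comm]

theorem WeightedCc.integrable_norm (f : WeightedCc A ω μ) :
    Integrable (fun s => ‖f s‖) (μ.withDensity fun s => (ω s : ℝ≥0∞)) :=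
  Continuous.integrable_of_hasCompactSupport
    (CompactlySupportedContinuousMap.toContinuousMap f).continuous.norm
    (CompactlySupportedContinuousMap.hasCompactSupport f).norm

instance : SeminormedAddCommGroup (WeightedCc A ω μ) :=
  fast_instance% AddGroupSeminorm.toSeminormedAddCommGroup
    { toFun := fun f => ‖f‖
      map_zero' := by
        rw [WeightedCc.norm_def]
        simp [show ∀ s, (0 : WeightedCc A ω μ) s = 0 from fun _ => rfl]
      add_le' := fun f g => by
        rw [WeightedCc.norm_eq, WeightedCc.norm_eq, WeightedCc.norm_eq,
          ← integral_add (WeightedCc.integrable_norm ω μ f) (WeightedCc.integrable_norm ω μ g)]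
        exact integral_mono (WeightedCc.integrable_norm ω μ (f + g))
          ((WeightedCc.integrable_norm ω μ f).add (WeightedCc.integrable_norm ω μ g))
          fun s => norm_add_le (f s) (g s)
      neg' := fun f => by
        rw [WeightedCc.norm_def, WeightedCc.norm_def]
        congr 1 with s
        rw [show (-f) s = -(f s) from rfl, norm_neg] }

instance : NormedSpace 𝕜 (WeightedCc A ω μ) where
  norm_smul_le c f := by
    rw [WeightedCc.norm_def, WeightedCc.norm_def, ← integral_const_mul]
    refine le_of_eq ?_
    congr 1 with s
    rw [show (c • f) s = c • f s from rfl, norm_smul, mul_assoc]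

variable (A) in
/-- `L¹(G, A, ω)`: the completion of `C_c(G, A)` for the norm `f ↦ ∫ ‖f(s)‖ ω(s) dμ(s)`. -/
abbrev WeightedL1 : Type _ := Completion (WeightedCc A ω μ)

/-- The canonical map of `C_c(G, A)` into `L¹(G, A, ω)`. -/
def toWeightedL1 (f : C_c(G, A)) : WeightedL1 A ω μ :=
  ((show WeightedCc A ω μ from f) : Completion (WeightedCc A ω μ))

end WeightedSpace

/-! ### Banach algebra dynamical systems and the twisted convolution -/

/-- A strongly continuous representation `α` of `G` on a Banach algebra `A` by bounded algebra
automorphisms (each `α r` is invertible with inverse `α r⁻¹`): together with `A` and `G` this is a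
Banach algebra dynamical system `(A, G, α)`. -/
structure BanachAlgebraAction (𝕜 G A : Type*) [RCLike 𝕜] [Group G] [TopologicalSpace G]
    [NonUnitalNormedRing A] [NormedSpace 𝕜 A] where
  toHom : G →* (A →L[𝕜] A)
  map_mul' : ∀ (r : G) (a b : A), toHom r (a * b) = toHom r a * toHom r b
  continuous' : ∀ a : A, Continuous fun r => toHom r a

section Convolution

variable {𝕜 : Type*} [RCLike 𝕜]
  {G : Type*} [Group G] [TopologicalSpace G]
  {A : Type*} [NonUnitalNormedRing A] [NormedSpace 𝕜 A]

instance : CoeFun (BanachAlgebraAction 𝕜 G A) (fun _ => G → A →L[𝕜] A) :=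
  ⟨fun α => ⇑α.toHom⟩

/-- `α` is uniformly bounded: `‖α_s‖ ≤ C` for some `C` and all `s`. -/
def BanachAlgebraAction.UniformlyBounded (α : BanachAlgebraAction 𝕜 G A) : Prop :=
  ∃ C : ℝ, ∀ s : G, ‖α s‖ ≤ C

variable [IsTopologicalGroup G] [LocallyCompactSpace G] [CompleteSpace A]

/-- `(r, a) ↦ α_r(a)` is jointly continuous. -/
theorem BanachAlgebraAction.continuous_uncurry (α : BanachAlgebraAction 𝕜 G A) :
    Continuous fun p : G × A => α p.1 p.2 := by
  rw [continuous_iff_continuousAt]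
  rintro ⟨r₀, a₀⟩
  obtain ⟨K, hK, hK0⟩ := exists_compact_mem_nhds r₀
  obtain ⟨C, hC⟩ : ∃ C, ∀ r : K, ‖α (r : G)‖ ≤ C := by
    refine banach_steinhaus (g := fun r : K => α (r : G)) fun a => ?_
    obtain ⟨C, hC⟩ := hK.exists_bound_of_continuousOn (α.continuous' a).continuousOn
    exact ⟨C, fun r => hC r r.2⟩
  rw [ContinuousAt, tendsto_iff_norm_sub_tendsto_zero]
  have h1 : Tendsto (fun p : G × A => C * ‖p.2 - a₀‖ + ‖α p.1 a₀ - α r₀ a₀‖)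
      (𝓝 (r₀, a₀)) (𝓝 0) := by
    have hc : Continuous (fun p : G × A => C * ‖p.2 - a₀‖ + ‖α p.1 a₀ - α r₀ a₀‖) :=
      (continuous_const.mul (continuous_snd.sub continuous_const).norm).add
        (((α.continuous' a₀).comp continuous_fst).sub continuous_const).norm
    simpa using hc.tendsto (r₀, a₀)
  refine squeeze_zero' (Eventually.of_forall fun _ => norm_nonneg _) ?_ h1
  filter_upwards [continuousAt_fst.preimage_mem_nhds hK0] with p hp
  calc ‖α p.1 p.2 - α r₀ a₀‖ = ‖α p.1 (p.2 - a₀) + (α p.1 a₀ - α r₀ a₀)‖ := by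
        rw [map_sub]; congr 1; abel
    _ ≤ ‖α p.1 (p.2 - a₀)‖ + ‖α p.1 a₀ - α r₀ a₀‖ := norm_add_le _ _
    _ ≤ C * ‖p.2 - a₀‖ + ‖α p.1 a₀ - α r₀ a₀‖ := by
        gcongr
        exact ((α p.1).le_opNorm _).trans (by gcongr; exact hC ⟨p.1, hp⟩)

variable [MeasurableSpace G] [BorelSpace G]
  [NormedSpace ℝ A]

theorem twistedConv_integrand_continuous (α : BanachAlgebraAction 𝕜 G A) (f g : C_c(G, A)) :
    Continuous fun p : G × G => f p.2 * α p.2 (g (p.2⁻¹ * p.1)) :=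
  (f.continuous.comp continuous_snd).mul
    (α.continuous_uncurry.comp
      (continuous_snd.prodMk (g.continuous.comp (continuous_snd.inv.mul continuous_fst))))

theorem twistedConv_integrand_eq_zero (α : BanachAlgebraAction 𝕜 G A) (f g : C_c(G, A)) (s r : G)
    (h : ¬(r ∈ tsupport f ∧ s ∈ tsupport f * tsupport g)) :
    f r * α r (g (r⁻¹ * s)) = 0 := by
  by_cases hr : r ∈ tsupport f
  · have hg : r⁻¹ * s ∉ tsupport g := fun hg =>
      h ⟨hr, Set.mem_mul.2 ⟨r, hr, r⁻¹ * s, hg, by group⟩⟩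
    rw [image_eq_zero_of_notMem_tsupport hg, map_zero, mul_zero]
  · rw [image_eq_zero_of_notMem_tsupport hr, zero_mul]

/-- The twisted convolution `[f * g](s) = ∫ f(r) α_r(g(r⁻¹ s)) dμ(r)` on `C_c(G, A)`. -/
def twistedConv [T2Space G] (μ : Measure G) [IsFiniteMeasureOnCompacts μ]
    (α : BanachAlgebraAction 𝕜 G A) (f g : C_c(G, A)) : C_c(G, A) where
  toFun s := ∫ r, f r * α r (g (r⁻¹ * s)) ∂μ
  continuous_toFun := by
    have h := continuousOn_integral_of_compact_support (μ := μ) (s := Set.univ)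
      (f := fun s r => f r * α r (g (r⁻¹ * s))) f.hasCompactSupport.isCompact
      (twistedConv_integrand_continuous α f g).continuousOn
      (fun s r _ hr => twistedConv_integrand_eq_zero α f g s r fun h => hr h.1)
    exact continuousOn_univ.1 h
  hasCompactSupport' := by
    refine HasCompactSupport.intro
      (f.hasCompactSupport.isCompact.mul g.hasCompactSupport.isCompact) fun s hs => ?_
    simp only [twistedConv_integrand_eq_zero α f g s _ fun h => hs h.2, integral_zero]

end Convolution

/-! ### The generalized Beurling algebra -/

section Beurling

variable {𝕜 : Type*} [RCLike 𝕜]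
  {G : Type*} [Group G] [TopologicalSpace G] [IsTopologicalGroup G] [T2Space G]
  [LocallyCompactSpace G] [MeasurableSpace G] [BorelSpace G]
  {A : Type*} [NonUnitalNormedRing A] [NormedSpace 𝕜 A] [IsScalarTower 𝕜 A A]
  [SMulCommClass 𝕜 A A] [CompleteSpace A] [NormedSpace ℝ A] [IsScalarTower ℝ 𝕜 A]

theorem twistedConv_integrable (μ : Measure G) [IsFiniteMeasureOnCompacts μ]
    (α : BanachAlgebraAction 𝕜 G A) (f g : C_c(G, A)) (s : G) :
    Integrable (fun r => f r * α r (g (r⁻¹ * s))) μ := by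
  refine Continuous.integrable_of_hasCompactSupport
    ((twistedConv_integrand_continuous α f g).comp (continuous_const.prodMk continuous_id)) ?_
  exact HasCompactSupport.intro f.hasCompactSupport.isCompact fun r hr =>
    twistedConv_integrand_eq_zero α f g s r fun h => hr h.1

/-- The twisted convolution as a bilinear map on `C_c(G, A)`. -/
def twistedConvLin (ω : GroupWeight G) (μ : Measure G) [IsFiniteMeasureOnCompacts μ]
    (α : BanachAlgebraAction 𝕜 G A) :
    WeightedCc A ω μ →ₗ[𝕜] WeightedCc A ω μ →ₗ[𝕜] WeightedCc A ω μ :=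
  LinearMap.mk₂ 𝕜 (fun f g => twistedConv μ α f g)
    (fun f f' g => by
      refine CompactlySupportedContinuousMap.ext fun s => ?_
      refine Eq.trans ?_ (integral_add (twistedConv_integrable μ α f g s)
        (twistedConv_integrable μ α f' g s))
      exact congrArg (fun F : G → A => ∫ r, F r ∂μ) (funext fun r => add_mul _ _ _))
    (fun c f g => by
      refine CompactlySupportedContinuousMap.ext fun s => ?_
      refine Eq.trans ?_ (integral_smul c _)
      exact congrArg (fun F : G → A => ∫ r, F r ∂μ) (funext fun r => smul_mul_assoc c _ _))
    (fun f g g' => by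
      refine CompactlySupportedContinuousMap.ext fun s => ?_
      refine Eq.trans ?_ (integral_add (twistedConv_integrable μ α f g s)
        (twistedConv_integrable μ α f g' s))
      refine congrArg (fun F : G → A => ∫ r, F r ∂μ) (funext fun r => ?_)
      rw [← mul_add, ← map_add]
      rfl)
    (fun c f g => by
      refine CompactlySupportedContinuousMap.ext fun s => ?_
      refine Eq.trans ?_ (integral_smul c _)
      refine congrArg (fun F : G → A => ∫ r, F r ∂μ) (funext fun r => ?_)
      rw [← mul_smul_comm, ← map_smul]
      rfl)

theorem twistedConvLin_apply (ω : GroupWeight G) (μ : Measure G) [IsFiniteMeasureOnCompacts μ]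
    (α : BanachAlgebraAction 𝕜 G A) (f g : WeightedCc A ω μ) (s : G) :
    twistedConvLin ω μ α f g s = ∫ r, f r * α r (g (r⁻¹ * s)) ∂μ := rfl

/-- `‖f * g‖ ≤ C ‖f‖ ‖g‖` if `α` is bounded by `C`. -/
theorem twistedConvLin_norm_le (ω : GroupWeight G) (μ : Measure G) [μ.IsHaarMeasure]
    (α : BanachAlgebraAction 𝕜 G A) {C : ℝ} (hC : ∀ s, ‖α s‖ ≤ C) (f g : WeightedCc A ω μ) :
    ‖twistedConvLin ω μ α f g‖ ≤ C * ‖f‖ * ‖g‖ := by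
  have hC0 : 0 ≤ C := (norm_nonneg _).trans (hC 1)
  have hfc : Continuous fun r => ‖f r‖ :=
    (CompactlySupportedContinuousMap.toContinuousMap f).continuous.norm
  have hgc : Continuous fun r => ‖g r‖ :=
    (CompactlySupportedContinuousMap.toContinuousMap g).continuous.norm
  have hfk : IsCompact (tsupport f) := CompactlySupportedContinuousMap.hasCompactSupport f
  have hgk : IsCompact (tsupport g) := CompactlySupportedContinuousMap.hasCompactSupport g
  set ν : Measure G := μ.withDensity fun s => (ω s : ℝ≥0∞) with hν
  let F : G → G → ℝ := fun s r => ‖f r‖ * ‖g (r⁻¹ * s)‖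
  have hFc : Continuous F.uncurry :=
    (hfc.comp continuous_snd).mul (hgc.comp (continuous_snd.inv.mul continuous_fst))
  have hF0 : ∀ s r, ¬(r ∈ tsupport f ∧ s ∈ tsupport f * tsupport g) → F s r = 0 := by
    intro s r h
    by_cases hr : r ∈ tsupport f
    · have hg : r⁻¹ * s ∉ tsupport g := fun hg =>
        h ⟨hr, Set.mem_mul.2 ⟨r, hr, r⁻¹ * s, hg, by group⟩⟩
      simp [F, image_eq_zero_of_notMem_tsupport hg]
    · simp [F, image_eq_zero_of_notMem_tsupport hr]
  have hFk : HasCompactSupport F.uncurry := by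
    refine HasCompactSupport.intro ((hfk.mul hgk).prod hfk) ?_
    rintro ⟨s, r⟩ h
    exact hF0 s r fun h' => h ⟨h'.2, h'.1⟩
  have hFr : ∀ s, Integrable (F s) μ := fun s =>
    Continuous.integrable_of_hasCompactSupport
      (hFc.comp (continuous_const.prodMk continuous_id))
      (HasCompactSupport.intro hfk fun r hr => hF0 s r fun h => hr h.1)
  have hIc : Continuous fun s => ∫ r, F s r ∂μ :=
    continuousOn_univ.1 (continuousOn_integral_of_compact_support hfk hFc.continuousOn
      fun s r _ hr => hF0 s r fun h => hr h.1)
  have hIk : HasCompactSupport fun s => ∫ r, F s r ∂μ :=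
    HasCompactSupport.intro (hfk.mul hgk) fun s hs => by
      simp only [hF0 s _ fun h => hs h.2, integral_zero]
  have hpt : ∀ s, ‖twistedConvLin ω μ α f g s‖ ≤ C * ∫ r, F s r ∂μ := by
    intro s
    rw [twistedConvLin_apply, ← integral_const_mul]
    refine norm_integral_le_of_norm_le ((hFr s).const_mul C) (Eventually.of_forall fun r => ?_)
    calc ‖f r * α r (g (r⁻¹ * s))‖ ≤ ‖f r‖ * ‖α r (g (r⁻¹ * s))‖ := norm_mul_le _ _
      _ ≤ ‖f r‖ * (C * ‖g (r⁻¹ * s)‖) := by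
          gcongr
          exact ((α r).le_opNorm _).trans (by gcongr; exact hC r)
      _ = C * F s r := by simp only [F]; ring
  have hinner : ∀ r, ∫ s, F s r ∂ν ≤ ‖f r‖ * ω r * ‖g‖ := by
    intro r
    have hbd : ∫ s, ‖g (r⁻¹ * s)‖ ∂ν ≤ ω r * ‖g‖ := by
      rw [hν, integral_withDensity_eq_integral_smul ω.measurable',
        ← integral_mul_left_eq_self _ r, WeightedCc.norm_def, ← integral_const_mul]
      have hgi : Integrable (fun s => ‖g s‖ * ω s) μ := by
        have := (integrable_withDensity_iff_integrable_smul ω.measurable').1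
          (WeightedCc.integrable_norm ω μ g)
        refine this.congr (Eventually.of_forall fun s => ?_)
        simp only [NNReal.smul_def, smul_eq_mul, mul_comm]
      refine integral_mono_of_nonneg (Eventually.of_forall fun s => by positivity)
        (hgi.const_mul _) (Eventually.of_forall fun s => ?_)
      have h1 : (ω (r * s) : ℝ) ≤ ω r * ω s := by exact_mod_cast ω.submul' r s
      simp only [inv_mul_cancel_left, NNReal.smul_def, smul_eq_mul]
      calc (ω (r * s) : ℝ) * ‖g s‖ ≤ ω r * ω s * ‖g s‖ := by gcongr
        _ = ω r * (‖g s‖ * ω s) := by ring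
    calc ∫ s, F s r ∂ν = ‖f r‖ * ∫ s, ‖g (r⁻¹ * s)‖ ∂ν := integral_const_mul _ _
      _ ≤ ‖f r‖ * (ω r * ‖g‖) := by gcongr
      _ = ‖f r‖ * ω r * ‖g‖ := by ring
  have hfi : Integrable (fun s => ‖f s‖ * ω s) μ := by
    have := (integrable_withDensity_iff_integrable_smul ω.measurable').1
      (WeightedCc.integrable_norm ω μ f)
    refine this.congr (Eventually.of_forall fun s => ?_)
    simp only [NNReal.smul_def, smul_eq_mul, mul_comm]
  calc ‖twistedConvLin ω μ α f g‖
      ≤ ∫ s, C * ∫ r, F s r ∂μ ∂ν := by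
        rw [WeightedCc.norm_eq]
        exact integral_mono (WeightedCc.integrable_norm ω μ _)
          ((hIc.integrable_of_hasCompactSupport hIk).const_mul C) hpt
    _ = C * ∫ r, ∫ s, F s r ∂ν ∂μ := by
        rw [integral_const_mul, integral_integral_swap_of_hasCompactSupport hFc hFk]
    _ ≤ C * (‖f‖ * ‖g‖) := by
        gcongr
        rw [WeightedCc.norm_def ω μ f, ← integral_mul_const]
        exact integral_mono_of_nonneg
          (Eventually.of_forall fun r => integral_nonneg fun s => by positivity)
          (hfi.mul_const _) (Eventually.of_forall hinner)
    _ = C * ‖f‖ * ‖g‖ := by ring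

variable (α : BanachAlgebraAction 𝕜 G A) (hα : α.UniformlyBounded) (ω : GroupWeight G)
  (μ : Measure G) [μ.IsHaarMeasure]

/-- The twisted convolution as a continuous bilinear map on `C_c(G, A)` with values in
`L¹(G, A, ω)`. -/
def twistedConvCc : WeightedCc A ω μ →L[𝕜] WeightedCc A ω μ →L[𝕜] WeightedL1 A ω μ :=
  LinearMap.mkContinuous₂
    ((twistedConvLin ω μ α).compr₂ (Completion.toComplL (𝕜 := 𝕜)).toLinearMap) hα.choose
    fun f g => (Completion.norm_coe _).trans_le (twistedConvLin_norm_le ω μ α hα.choose_spec f g)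

/-- The multiplication of the generalized Beurling algebra `L¹(G, A, ω; α)`: the unique continuous
bilinear extension to `L¹(G, A, ω)` of the twisted convolution on `C_c(G, A)`. -/
def beurlingMul : WeightedL1 A ω μ →L[𝕜] WeightedL1 A ω μ →L[𝕜] WeightedL1 A ω μ :=
  (((twistedConvCc α hα ω μ).extend Completion.toComplL).flip.extend Completion.toComplL).flip

theorem beurlingMul_coe (f g : C_c(G, A)) :
    beurlingMul α hα ω μ (toWeightedL1 ω μ f) (toWeightedL1 ω μ g) =
      toWeightedL1 ω μ (twistedConv μ α f g) := by
  have hd : DenseRange (Completion.toComplL (𝕜 := 𝕜) (E := WeightedCc A ω μ)) :=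
    Completion.denseRange_coe
  have hu : IsUniformInducing (Completion.toComplL (𝕜 := 𝕜) (E := WeightedCc A ω μ)) :=
    Completion.isUniformInducing_coe _
  have h1 := ContinuousLinearMap.extend_eq (twistedConvCc α hα ω μ) hd hu f
  have h2 := ContinuousLinearMap.extend_eq
    ((twistedConvCc α hα ω μ).extend Completion.toComplL).flip hd hu g
  exact (congrArg (fun L => L (toWeightedL1 ω μ f)) h2).trans (congrArg (fun L => L g) h1)

end Beurling

/-! ### Representations -/

section Representations

variable {𝕜 : Type*} [RCLike 𝕜]
  {G : Type*} [Group G] [TopologicalSpace G]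
  {A : Type*} [NonUnitalNormedRing A] [NormedSpace 𝕜 A]

/-- A continuous covariant representation `(π, U)` of `(A, G, α)` on `X`: `π` is a norm-bounded
algebra representation of `A`, `U` is a strongly continuous representation of `G`, and
`π(α_s(a)) = U_s π(a) U_s⁻¹`. (Multiplication in `X →L[𝕜] X` is composition.) -/
@[ext]
structure ContinuousCovariantRep (α : BanachAlgebraAction 𝕜 G A)
    (X : Type*) [NormedAddCommGroup X] [NormedSpace 𝕜 X] where
  π : A →L[𝕜] (X →L[𝕜] X)
  U : G →* (X →L[𝕜] X)
  π_mul : ∀ a b : A, π (a * b) = π a * π b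
  U_continuous : ∀ x : X, Continuous fun r => U r x
  covariant : ∀ (s : G) (a : A), π (α s a) = U s * π a * U s⁻¹

/-- `(π, U)` is non-degenerate: the span of `π(A)X` is dense in `X`. -/
def ContinuousCovariantRep.Nondegenerate {α : BanachAlgebraAction 𝕜 G A}
    {X : Type*} [NormedAddCommGroup X] [NormedSpace 𝕜 X]
    (p : ContinuousCovariantRep α X) : Prop :=
  Dense (Submodule.span 𝕜 {y : X | ∃ (a : A) (x : X), p.π a x = y} : Set X)

/-- The condition `‖U_r‖ ≤ C ω(r)` for some `C ≥ 0` and all `r`. -/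
def ContinuousCovariantRep.BoundedByWeight [MeasurableSpace G] {α : BanachAlgebraAction 𝕜 G A}
    {X : Type*} [NormedAddCommGroup X] [NormedSpace 𝕜 X]
    (p : ContinuousCovariantRep α X) (ω : GroupWeight G) : Prop :=
  ∃ C : ℝ, 0 ≤ C ∧ ∀ r : G, ‖p.U r‖ ≤ C * ω r

variable [IsTopologicalGroup G] [T2Space G] [LocallyCompactSpace G] [MeasurableSpace G]
  [BorelSpace G] [IsScalarTower 𝕜 A A] [SMulCommClass 𝕜 A A] [CompleteSpace A]
  [NormedSpace ℝ A] [IsScalarTower ℝ 𝕜 A]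

/-- A bounded representation of the generalized Beurling algebra `L¹(G, A, ω; α)` on `X`. -/
@[ext]
structure BeurlingRep (α : BanachAlgebraAction 𝕜 G A) (hα : α.UniformlyBounded)
    (ω : GroupWeight G) (μ : Measure G) [μ.IsHaarMeasure]
    (X : Type*) [NormedAddCommGroup X] [NormedSpace 𝕜 X] where
  T : WeightedL1 A ω μ →L[𝕜] (X →L[𝕜] X)
  T_mul : ∀ u v : WeightedL1 A ω μ, T (beurlingMul α hα ω μ u v) = T u * T v

/-- `T` is non-degenerate: the span of `T(L¹(G, A, ω; α))X` is dense in `X`. -/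
def BeurlingRep.Nondegenerate {α : BanachAlgebraAction 𝕜 G A} {hα : α.UniformlyBounded}
    {ω : GroupWeight G} {μ : Measure G} [μ.IsHaarMeasure]
    {X : Type*} [NormedAddCommGroup X] [NormedSpace 𝕜 X]
    (T : BeurlingRep α hα ω μ X) : Prop :=
  Dense (Submodule.span 𝕜 {y : X | ∃ (u : WeightedL1 A ω μ) (x : X), T.T u x = y} : Set X)

end Representations

/-! ### Approximate identities and approximations of the point mass at the identity -/

section Approximation

/-- The net `u` is a left approximate identity of `A`: `u_i a → a` for all `a`. -/
def IsLeftApproxIdentity {A I : Type*} [NonUnitalNormedRing A] [Preorder I] (u : I → A) : Prop :=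
  ∀ a : A, Tendsto (fun i => u i * a) atTop (𝓝 a)

/-- The net `u` is a right approximate identity of `A`: `a u_i → a` for all `a`. -/
def IsRightApproxIdentity {A I : Type*} [NonUnitalNormedRing A] [Preorder I] (u : I → A) : Prop :=
  ∀ a : A, Tendsto (fun i => a * u i) atTop (𝓝 a)

variable {G : Type*} [Group G] [TopologicalSpace G]

/-- `Z` is a neighbourhood base of the identity of `G`, all of whose elements are contained in a
fixed compact subset of `G`. -/
structure IsBoundedNhdsBase (Z : Set (Set G)) : Prop where
  mem_nhds : ∀ V ∈ Z, V ∈ 𝓝 (1 : G)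
  exists_subset : ∀ N ∈ 𝓝 (1 : G), ∃ V ∈ Z, V ⊆ N
  exists_compact : ∃ K : Set G, IsCompact K ∧ ∀ V ∈ Z, V ⊆ K

/-- `z_V ∈ C_c(G)` is non-negative, vanishes outside `V`, and `∫ z_V dμ = 1`, for all `V ∈ Z`. -/
structure IsApproxDelta [MeasurableSpace G] (μ : Measure G) (Z : Set (Set G))
    (z : Z → C_c(G, ℝ)) : Prop where
  nonneg : ∀ (V : Z) (r : G), 0 ≤ z V r
  eq_zero : ∀ (V : Z) (r : G), r ∉ (V : Set G) → z V r = 0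
  integral_eq_one : ∀ V : Z, ∫ r, z V r ∂μ = 1

/-- The left translate `z(s⁻¹ ·)`. -/
def leftTranslate [IsTopologicalGroup G] (s : G) (z : C_c(G, ℝ)) : C_c(G, ℝ) where
  toFun r := z (s⁻¹ * r)
  continuous_toFun := z.continuous.comp (continuous_const.mul continuous_id)
  hasCompactSupport' := z.hasCompactSupport.comp_homeomorph (Homeomorph.mulLeft s⁻¹)

/-- `z ⊗ a ∈ C_c(G, A)`, the function `r ↦ z(r) a`. -/
def tensorCc {A : Type*} [NormedAddCommGroup A] [NormedSpace ℝ A]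
    (z : C_c(G, ℝ)) (a : A) : C_c(G, A) where
  toFun r := z r • a
  continuous_toFun := z.continuous.smul continuous_const
  hasCompactSupport' := z.hasCompactSupport.smul_right

/-- `inf_{V ∈ Z} sup_{r ∈ V} ω(r)`. (Inner suprema are over sets on which `ω` is bounded, when all
`V ∈ Z` lie in a fixed compact set.) -/
def infSupWeight [MeasurableSpace G] (ω : GroupWeight G) (Z : Set (Set G)) : ℝ :=
  ⨅ V : Z, ⨆ r : (V : Set G), (ω r : ℝ)

end Approximation

end

open scoped BoundedContinuousFunction

noncomputable section

/-! ### Compactly supported functions in the weighted space -/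

section WeightedL1Basics

variable {𝕜 : Type*} [RCLike 𝕜]
  {G : Type*} [Group G] [TopologicalSpace G] [IsTopologicalGroup G] [T2Space G]
  [LocallyCompactSpace G] [MeasurableSpace G] [BorelSpace G]
  {A : Type*} [NormedAddCommGroup A] [NormedSpace 𝕜 A]
  (ω : GroupWeight G) (μ : Measure G) [IsFiniteMeasureOnCompacts μ]

/-! Both groups of data act on the Beurling algebra itself: `A` by pointwise left multiplication,
written L_a, and `G` by twisted translation, (Λ_s f)(r) = α_s(f(s⁻¹r)). These operators are left
centralizers, meaning that they act only on the left factor of a convolution. They satisfy Λ_s L_a =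
L_{α_s(a)} Λ_s and ‖Λ_s‖ ≤ ‖α_s‖ ω(s), and Λ is strongly continuous. The convolution is a
superposition of them: f * g = ∫ L_{f(r)} Λ_r g dr, a Bochner integral in the weighted space
(`beurlingMul_coe_eq_integral`).

The correspondence is governed by the intertwining relations π(a)T(u) = T(L_a u) and U_s T(u) =
T(Λ_s u). The integrated form of (π,U) satisfies them. Conversely, the net w = z_V ⊗ e_j is
eventually bounded and is a left approximate identity on `C_c(G, A)`, so for a non-degenerate T and
a left centralizer D the operators T(Dw) converge strongly to some S with S T(u) = T(Du)
(`BeurlingRep.Nondegenerate.exists_operator`). Taking D = L_a and D = Λ_s produces π and U, and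
relations between centralizers become relations between π and U because the vectors T(u)x have dense
span.

Applying T to the integral for f * g gives T(f * g)x = ∫ π(f(r)) U_r T(g)x dr
(`apply_beurlingMul_eq_integral`). For the integrated form this is multiplicativity; for a given T
it says that T is the integrated form of the pair built from it. Injectivity holds because the
intertwining relations determine π and U on a dense subspace.

The limit formulas come from writing T(z_V(s⁻¹·) ⊗ b)x as the average of π(b)U_{sr}x against z_V(r)
(`ContinuousCovariantRep.tendsto_integratedForm_tensorCc`). The bounds on π and U follow by
estimating the L¹ norms along these limits (`BeurlingRep.norm_le_of_tendsto`). -/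

theorem norm_toWeightedL1 (f : C_c(G, A)) :
    ‖toWeightedL1 ω μ f‖ = ∫ s, ‖f s‖ * ω s ∂μ :=
  Completion.norm_coe _

theorem norm_toWeightedL1_eq_integral_withDensity (f : C_c(G, A)) :
    ‖toWeightedL1 ω μ f‖ = ∫ s, ‖f s‖ ∂(μ.withDensity fun s => (ω s : ℝ≥0∞)) :=
  (Completion.norm_coe _).trans (WeightedCc.norm_eq ω μ f)

theorem integrable_norm_mul_weight (f : C_c(G, A)) :
    Integrable (fun s => ‖f s‖ * ω s) μ := by
  have := (integrable_withDensity_iff_integrable_smul ω.measurable').1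
    (WeightedCc.integrable_norm ω μ f)
  refine this.congr (Eventually.of_forall fun s => ?_)
  simp only [NNReal.smul_def, smul_eq_mul]
  exact mul_comm _ _

variable (𝕜) in
/-- The canonical map of `C_c(G, A)` into `L¹(G, A, ω)` as a linear map. -/
def toWeightedL1Lin : C_c(G, A) →ₗ[𝕜] WeightedL1 A ω μ where
  toFun := toWeightedL1 ω μ
  map_add' f g := Completion.coe_add (α := WeightedCc A ω μ) f g
  map_smul' c f := Completion.coe_smul c (show WeightedCc A ω μ from f)

@[simp]
theorem toWeightedL1Lin_apply (f : C_c(G, A)) :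
    toWeightedL1Lin 𝕜 ω μ f = toWeightedL1 ω μ f := rfl

variable (A) in
theorem denseRange_toWeightedL1 : DenseRange (toWeightedL1 (A := A) ω μ) :=
  Completion.denseRange_coe (α := WeightedCc A ω μ)

theorem toWeightedL1_sub (f g : C_c(G, A)) :
    toWeightedL1 ω μ (f - g) = toWeightedL1 ω μ f - toWeightedL1 ω μ g :=
  Completion.coe_sub (α := WeightedCc A ω μ) f g

theorem WeightedL1.ext_clm {Y : Type*} [NormedAddCommGroup Y] [NormedSpace 𝕜 Y]
    {S S' : WeightedL1 A ω μ →L[𝕜] Y}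
    (h : ∀ f : C_c(G, A), S (toWeightedL1 ω μ f) = S' (toWeightedL1 ω μ f)) : S = S' :=
  ContinuousLinearMap.coeFn_injective
    ((denseRange_toWeightedL1 A ω μ).equalizer S.continuous S'.continuous (funext h))

/-- On functions supported in a compact set the weighted norm is dominated by the supremum norm. -/
theorem exists_norm_toWeightedL1_le (A : Type*) [NormedAddCommGroup A] {K : Set G}
    (hK : IsCompact K) :
    ∃ C : ℝ, 0 ≤ C ∧ ∀ (f : C_c(G, A)) (ε : ℝ), (∀ s, s ∉ K → f s = 0) → (∀ s, ‖f s‖ ≤ ε) →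
      ‖toWeightedL1 ω μ f‖ ≤ C * ε := by
  set ν := μ.withDensity fun s => (ω s : ℝ≥0∞) with hν
  -- The constant is the mass of K under ω dμ, finite because weights are bounded on compact sets.
  refine ⟨ν.real K, measureReal_nonneg, fun f ε hf hε => ?_⟩
  rw [norm_toWeightedL1_eq_integral_withDensity, ← hν,
    ← setIntegral_eq_integral_of_forall_compl_eq_zero (s := K)
      (fun s hs => by rw [hf s hs, norm_zero])]
  have h := norm_setIntegral_le_of_norm_le_const (μ := ν) (f := fun s => ‖f s‖)
    hK.measure_lt_top (C := ε) (fun s _ => by rw [norm_norm]; exact hε s)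
  rw [mul_comm]
  exact (le_abs_self _).trans h

/-- A jointly continuous family of functions with supports in a fixed compact set is uniformly
continuous in the parameter. -/
theorem eventually_norm_sub_le_of_compact_support {P E : Type*} [TopologicalSpace P]
    [NormedAddCommGroup E] {F : P → G → E} (hF : Continuous fun q : P × G => F q.1 q.2)
    {K : Set G} (hK : IsCompact K) {p₀ : P}
    (hsupp : ∀ᶠ p in 𝓝 p₀, ∀ s, s ∉ K → F p s = 0) {ε : ℝ} (hε : 0 < ε) :
    ∀ᶠ p in 𝓝 p₀, ∀ s, ‖F p s - F p₀ s‖ ≤ ε := by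
  have hc : Continuous fun q : P × G => ‖F q.1 q.2 - F p₀ q.2‖ :=
    (hF.sub (hF.comp (continuous_const.prodMk continuous_snd))).norm
  -- Compactness of K makes the local estimates near each (p₀, s) uniform in s, as in the tube
  -- lemma.
  have h1 : ∀ᶠ p in 𝓝 p₀, ∀ s ∈ K, ‖F p s - F p₀ s‖ < ε := by
    refine hK.eventually_forall_of_forall_eventually fun s _ => ?_
    exact hc.continuousAt.eventually_lt_const (by simpa using hε)
  filter_upwards [h1, hsupp] with p hp hs s
  by_cases hsK : s ∈ K
  · exact (hp s hsK).le
  · rw [hs s hsK, hsupp.self_of_nhds s hsK]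
    simpa using hε.le

theorem tendsto_toWeightedL1 {P : Type*} {l : Filter P} {F : P → C_c(G, A)} {f : C_c(G, A)}
    {K : Set G} (hK : IsCompact K) (hF : ∀ᶠ p in l, ∀ s, s ∉ K → F p s = 0)
    (hf : ∀ s, s ∉ K → f s = 0)
    (h : ∀ ε : ℝ, 0 < ε → ∀ᶠ p in l, ∀ s, ‖F p s - f s‖ ≤ ε) :
    Tendsto (fun p => toWeightedL1 ω μ (F p)) l (𝓝 (toWeightedL1 ω μ f)) := by
  obtain ⟨C, hC0, hC⟩ := exists_norm_toWeightedL1_le ω μ A hK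
  rw [Metric.tendsto_nhds]
  intro ε hε
  filter_upwards [hF, h (ε / (C + 1)) (by positivity)] with p hp hp'
  rw [dist_eq_norm, ← toWeightedL1_sub]
  refine (hC (F p - f) (ε / (C + 1)) (fun s hs => ?_) fun s => ?_).trans_lt ?_
  · simp [hp s hs, hf s hs]
  · simpa using hp' s
  · rw [mul_div_assoc', div_lt_iff₀ (by positivity)]
    nlinarith

theorem continuousAt_toWeightedL1 {P : Type*} [TopologicalSpace P] {F : P → C_c(G, A)}
    (hF : Continuous fun q : P × G => F q.1 q.2) {K : Set G} (hK : IsCompact K) {p₀ : P}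
    (hsupp : ∀ᶠ p in 𝓝 p₀, ∀ s, s ∉ K → F p s = 0) :
    ContinuousAt (fun p => toWeightedL1 ω μ (F p)) p₀ :=
  tendsto_toWeightedL1 ω μ hK hsupp hsupp.self_of_nhds fun _ hε =>
    eventually_norm_sub_le_of_compact_support (F := fun p => F p) hF hK hsupp hε

/-- The bounded continuous functions on `G` that vanish outside `K`. -/
def boundedFunctionsSupportedIn (A : Type*) [NormedAddCommGroup A] [NormedSpace ℝ A] (K : Set G) :
    Submodule ℝ (G →ᵇ A) where
  carrier := {f | ∀ s, s ∉ K → f s = 0}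
  add_mem' hf hg s hs := by simp [hf s hs, hg s hs]
  zero_mem' _ _ := rfl
  smul_mem' c f hf s hs := by simp [hf s hs]

theorem isClosed_boundedFunctionsSupportedIn [NormedSpace ℝ A] (K : Set G) :
    IsClosed (boundedFunctionsSupportedIn A K : Set (G →ᵇ A)) := by
  have : (boundedFunctionsSupportedIn A K : Set (G →ᵇ A)) = ⋂ s ∈ Kᶜ, {f | f s = 0} := by
    ext f
    simp only [Set.mem_iInter]
    rfl
  rw [this]
  exact isClosed_biInter fun s _ => isClosed_eq (by fun_prop) continuous_const

/-- The inclusion of the bounded continuous functions supported in a compact set into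
`C_c(G, A)`. -/
def boundedFunctionsSupportedInToCc [NormedSpace ℝ A] {K : Set G} (hK : IsCompact K) :
    boundedFunctionsSupportedIn A K →ₗ[ℝ] C_c(G, A) where
  toFun f := ⟨f.1.toContinuousMap, HasCompactSupport.intro hK f.2⟩
  map_add' _ _ := rfl
  map_smul' _ _ := rfl

/-- On a fixed compact support the supremum norm dominates the weighted norm, so the inclusion is
bounded and commutes with Bochner integrals. -/
theorem exists_clm_boundedFunctionsSupportedIn [NormedSpace ℝ A] {K : Set G} (hK : IsCompact K) :
    ∃ J : boundedFunctionsSupportedIn A K →L[ℝ] WeightedL1 A ω μ,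
      ∀ f, J f = toWeightedL1 ω μ (boundedFunctionsSupportedInToCc hK f) := by
  obtain ⟨C, hC0, hC⟩ := exists_norm_toWeightedL1_le ω μ A hK
  exact ⟨LinearMap.mkContinuous ((toWeightedL1Lin ℝ ω μ).comp (boundedFunctionsSupportedInToCc hK))
    C fun f => hC _ _ f.2 fun s => f.1.norm_coe_le_norm s, fun f => rfl⟩

/-- A superposition of compactly supported functions, computed pointwise, agrees with the Bochner
integral in `L¹(G, A, ω)`. -/
theorem toWeightedL1_eq_integral [NormedSpace ℝ A] [CompleteSpace A] {K₁ K₂ : Set G}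
    (hK₁ : IsCompact K₁) (hK₂ : IsCompact K₂) {F : G → C_c(G, A)}
    (hF : Continuous fun q : G × G => F q.1 q.2) (h₁ : ∀ r, r ∉ K₁ → ∀ s, F r s = 0)
    (h₂ : ∀ r s, s ∉ K₂ → F r s = 0) {f : C_c(G, A)} (hf : ∀ s, f s = ∫ r, F r s ∂μ) :
    toWeightedL1 ω μ f = ∫ r, toWeightedL1 ω μ (F r) ∂μ := by
  have : CompleteSpace (boundedFunctionsSupportedIn A K₂) :=
    (isClosed_boundedFunctionsSupportedIn K₂).completeSpace_coe
  obtain ⟨J, hJ⟩ := exists_clm_boundedFunctionsSupportedIn (A := A) ω μ hK₂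
  -- Point evaluations need not be continuous for the weighted norm. The family is therefore
  -- integrated in a Banach space with the supremum norm, where evaluations are continuous and
  -- identify the integral with f, and the result is pushed into L¹ by J.
  let Φ : G → boundedFunctionsSupportedIn A K₂ := fun r =>
    ⟨(F r : G →ᵇ A), fun s hs => h₂ r s hs⟩
  have hΦc : Continuous Φ := by
    refine continuous_iff_continuousAt.2 fun r₀ => ?_
    rw [ContinuousAt, Metric.tendsto_nhds]
    intro ε hε
    filter_upwards [eventually_norm_sub_le_of_compact_support (F := fun r => F r) hF hK₂
      (Eventually.of_forall h₂) (half_pos hε)] with r hr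
    refine lt_of_le_of_lt ?_ (half_lt_self hε)
    exact (BoundedContinuousFunction.dist_le (half_pos hε).le).2 fun s =>
      (dist_eq_norm _ _).trans_le (hr s)
  have hΦi : Integrable Φ μ :=
    hΦc.integrable_of_hasCompactSupport (HasCompactSupport.intro hK₁ fun r hr =>
      Subtype.ext (BoundedContinuousFunction.ext fun s => h₁ r hr s))
  have hf' : f = boundedFunctionsSupportedInToCc hK₂ (∫ r, Φ r ∂μ) := by
    refine CompactlySupportedContinuousMap.ext fun s => (hf s).trans ?_
    exact ContinuousLinearMap.integral_comp_comm
      ((BoundedContinuousFunction.evalCLM ℝ s).comp (boundedFunctionsSupportedIn A K₂).subtypeL) hΦi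
  rw [hf', ← hJ, ← J.integral_comp_comm hΦi]
  simp only [hJ]
  rfl

end WeightedL1Basics

end
noncomputable section

/-! ### Pointwise limits of bounded nets of operators -/

section PointwiseLimits

variable {𝕜 : Type*} [RCLike 𝕜]
  {E : Type*} [NormedAddCommGroup E] [NormedSpace 𝕜 E]
  {F : Type*} [NormedAddCommGroup F] [NormedSpace 𝕜 F]

/-- Linearity carries convergence from D to its span, and the uniform bound carries it to the
closure. -/
theorem tendsto_apply_of_dense_span {Q : Type*} {l : Filter Q} {S : Q → E →L[𝕜] F}
    {S₀ : E →L[𝕜] F} {κ : ℝ} (hb : ∀ᶠ q in l, ‖S q‖ ≤ κ) {D : Set E}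
    (hD : Dense (Submodule.span 𝕜 D : Set E))
    (h : ∀ x ∈ D, Tendsto (fun q => S q x) l (𝓝 (S₀ x))) (x : E) :
    Tendsto (fun q => S q x) l (𝓝 (S₀ x)) := by
  have hspan : ∀ y ∈ Submodule.span 𝕜 D, Tendsto (fun q => S q y) l (𝓝 (S₀ y)) := by
    intro y hy
    induction hy using Submodule.span_induction with
    | mem y hy => exact h y hy
    | zero => simpa using tendsto_const_nhds
    | add y y' _ _ hy hy' => simpa using hy.add hy'
    | smul c y _ hy => simpa using hy.const_smul c
  rw [Metric.tendsto_nhds]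
  intro ε hε
  -- This radius keeps (|κ| + ‖S₀‖)‖x - y‖ below ε/2. The absolute value is there because κ may be
  -- negative when l is trivial.
  obtain ⟨y, hyD, hy⟩ := Metric.dense_iff.1 hD x (ε / (2 * (|κ| + ‖S₀‖ + 1))) (by positivity)
  have hxy : ‖x - y‖ < ε / (2 * (|κ| + ‖S₀‖ + 1)) := by
    rw [← dist_eq_norm, dist_comm]; exact hyD
  rw [lt_div_iff₀ (by positivity)] at hxy
  filter_upwards [hb, Metric.tendsto_nhds.1 (hspan y hy) (ε / 2) (half_pos hε)] with q hq hq'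
  rw [dist_eq_norm] at hq' ⊢
  have h1 : ‖S q (x - y)‖ ≤ |κ| * ‖x - y‖ :=
    ((S q).le_opNorm _).trans (by gcongr; exact hq.trans (le_abs_self κ))
  have h2 : ‖S₀ (x - y)‖ ≤ ‖S₀‖ * ‖x - y‖ := S₀.le_opNorm _
  have h3 : S q x - S₀ x = S q (x - y) + (S q y - S₀ y) - S₀ (x - y) := by
    simp only [map_sub]; abel
  rw [h3]
  have h4 := norm_sub_le (S q (x - y) + (S q y - S₀ y)) (S₀ (x - y))
  have h5 := norm_add_le (S q (x - y)) (S q y - S₀ y)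
  nlinarith [norm_nonneg (x - y)]

/-- The same approximation shows that the values at each vector form a Cauchy net. Completeness
gives a limit, and linearity and the bound κ survive the limit. -/
theorem exists_clm_of_tendsto_on_dense_span [CompleteSpace F] {Q : Type*} {l : Filter Q} [l.NeBot]
    {S : Q → E →L[𝕜] F} {κ : ℝ} (hb : ∀ᶠ q in l, ‖S q‖ ≤ κ) {D : Set E}
    (hD : Dense (Submodule.span 𝕜 D : Set E))
    (h : ∀ x ∈ D, ∃ y, Tendsto (fun q => S q x) l (𝓝 y)) :
    ∃ S₀ : E →L[𝕜] F, ‖S₀‖ ≤ κ ∧ ∀ x, Tendsto (fun q => S q x) l (𝓝 (S₀ x)) := by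
  have hκ : 0 ≤ κ := by
    obtain ⟨q, hq⟩ := hb.exists
    exact (norm_nonneg _).trans hq
  have hspan : ∀ y ∈ Submodule.span 𝕜 D, ∃ z, Tendsto (fun q => S q y) l (𝓝 z) := by
    intro y hy
    induction hy using Submodule.span_induction with
    | mem y hy => exact h y hy
    | zero => exact ⟨0, by simp⟩
    | add y y' _ _ hy hy' =>
      obtain ⟨z, hz⟩ := hy
      obtain ⟨z', hz'⟩ := hy'
      exact ⟨z + z', by simpa using hz.add hz'⟩
    | smul c y _ hy =>
      obtain ⟨z, hz⟩ := hy
      exact ⟨c • z, by simpa using hz.const_smul c⟩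
  have hall : ∀ x, ∃ z, Tendsto (fun q => S q x) l (𝓝 z) := by
    intro x
    refine cauchy_map_iff_exists_tendsto.1 (Metric.cauchy_iff.2 ⟨inferInstance, fun ε hε => ?_⟩)
    obtain ⟨y, hyD, hy⟩ := Metric.dense_iff.1 hD x (ε / (4 * (κ + 1))) (by positivity)
    have hxy : ‖x - y‖ < ε / (4 * (κ + 1)) := by
      rw [← dist_eq_norm, dist_comm]; exact hyD
    rw [lt_div_iff₀ (by positivity)] at hxy
    obtain ⟨z, hz⟩ := hspan y hy
    refine ⟨Metric.ball z (ε / 2), ?_, fun a ha b hb => ?_⟩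
    · rw [mem_map]
      filter_upwards [hb, Metric.tendsto_nhds.1 hz (ε / 4) (by positivity)] with q hq hq'
      rw [dist_eq_norm] at hq'
      rw [Set.mem_preimage, mem_ball_iff_norm]
      have h1 : ‖S q (x - y)‖ ≤ κ * ‖x - y‖ := ((S q).le_opNorm _).trans (by gcongr)
      have h3 : S q x - z = S q (x - y) + (S q y - z) := by
        simp only [map_sub]; abel
      rw [h3]
      have h5 := norm_add_le (S q (x - y)) (S q y - z)
      nlinarith [norm_nonneg (x - y)]
    · calc dist a b ≤ dist a z + dist b z := dist_triangle_right _ _ _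
        _ < ε / 2 + ε / 2 := add_lt_add ha hb
        _ = ε := add_halves ε
  choose g hg using hall
  refine ⟨(linearMapOfTendsto g (fun q => (S q : E →ₗ[𝕜] F)) (tendsto_pi_nhds.2 hg)).mkContinuous κ
    fun x => ?_, LinearMap.mkContinuous_norm_le _ hκ _, hg⟩
  refine le_of_tendsto (hg x).norm ?_
  filter_upwards [hb] with q hq
  exact ((S q).le_opNorm _).trans (by gcongr)

end PointwiseLimits

/-! ### Averages against approximations of the point mass -/

section Averages

variable {G : Type*} [Group G] [TopologicalSpace G]

/-- A net of probability densities in `C_c(G)` that concentrates at the identity. -/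
structure IsDeltaNet [MeasurableSpace G] (μ : Measure G) {Q : Type*} (l : Filter Q)
    (z : Q → C_c(G, ℝ)) : Prop where
  nonneg : ∀ (q : Q) (r : G), 0 ≤ z q r
  integral_eq_one : ∀ q : Q, ∫ r, z q r ∂μ = 1
  eventually_eq_zero : ∀ N ∈ 𝓝 (1 : G), ∀ᶠ q in l, ∀ r, r ∉ N → z q r = 0

/-- Once V lies inside N, every later index has its density supported in V. The factor I plays no
part in concentration; it is present to let an approximate identity run along the same filter. -/
theorem IsApproxDelta.isDeltaNet [MeasurableSpace G] {μ : Measure G} {Z : Set (Set G)}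
    (hZ : IsBoundedNhdsBase Z) {z : Z → C_c(G, ℝ)} (hz : IsApproxDelta μ Z z)
    {I : Type*} [Preorder I] [Nonempty I] :
    IsDeltaNet μ (atTop : Filter (Zᵒᵈ × I)) fun q => z (OrderDual.ofDual q.1) where
  nonneg _ r := hz.nonneg _ r
  integral_eq_one _ := hz.integral_eq_one _
  eventually_eq_zero N hN := by
    obtain ⟨V, hV, hVN⟩ := hZ.exists_subset N hN
    obtain ⟨i⟩ := ‹Nonempty I›
    filter_upwards [eventually_ge_atTop ((OrderDual.toDual ⟨V, hV⟩, i) : Zᵒᵈ × I)] with q hq r hr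
    exact hz.eq_zero _ r fun h => hr (hVN (hq.1 h))

theorem IsBoundedNhdsBase.isDirectedOrder {Z : Set (Set G)} (hZ : IsBoundedNhdsBase Z) :
    IsDirectedOrder Zᵒᵈ where
  directed V W := by
    obtain ⟨U, hU, hUVW⟩ := hZ.exists_subset _
      (inter_mem (hZ.mem_nhds _ (OrderDual.ofDual V).2) (hZ.mem_nhds _ (OrderDual.ofDual W).2))
    exact ⟨OrderDual.toDual ⟨U, hU⟩, fun _ h => (hUVW h).1, fun _ h => (hUVW h).2⟩

theorem IsBoundedNhdsBase.nonempty {Z : Set (Set G)} (hZ : IsBoundedNhdsBase Z) :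
    Nonempty Z := by
  obtain ⟨V, hV, _⟩ := hZ.exists_subset _ univ_mem
  exact ⟨⟨V, hV⟩⟩

theorem IsBoundedNhdsBase.neBot_atTop {Z : Set (Set G)} (hZ : IsBoundedNhdsBase Z)
    {I : Type*} [Preorder I] [IsDirectedOrder I] [Nonempty I] :
    (atTop : Filter (Zᵒᵈ × I)).NeBot := by
  have := hZ.isDirectedOrder
  have : Nonempty Zᵒᵈ := hZ.nonempty
  rw [← prod_atTop_atTop_eq]
  infer_instance

variable [IsTopologicalGroup G] [T2Space G]
  [LocallyCompactSpace G] [MeasurableSpace G] [BorelSpace G]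

/-- A Urysohn function equal to 1 at the identity and vanishing off the interior of V has positive
Haar integral, so it can be normalised. -/
theorem IsBoundedNhdsBase.exists_isApproxDelta {Z : Set (Set G)} (hZ : IsBoundedNhdsBase Z)
    (μ : Measure G) [μ.IsHaarMeasure] : ∃ z : Z → C_c(G, ℝ), IsApproxDelta μ Z z := by
  have key : ∀ V : Z, ∃ z : C_c(G, ℝ), (∀ r, 0 ≤ z r) ∧ (∀ r, r ∉ (V : Set G) → z r = 0) ∧
      ∫ r, z r ∂μ = 1 := by
    intro V
    have h1 : (1 : G) ∈ interior (V : Set G) := mem_interior_iff_mem_nhds.2 (hZ.mem_nhds V V.2)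
    obtain ⟨f, hf1, hf0, hfc, hf01⟩ := exists_continuous_one_zero_of_isCompact
      (isCompact_singleton (x := (1 : G))) (isOpen_interior (s := (V : Set G))).isClosed_compl
      (Set.disjoint_singleton_left.2 fun h => h h1)
    have hpos : 0 < ∫ r, f r ∂μ :=
      f.continuous.integral_pos_of_hasCompactSupport_nonneg_nonzero hfc (fun r => (hf01 r).1)
        (x := 1) (by rw [hf1 (Set.mem_singleton _)]; simp)
    refine ⟨(∫ r, f r ∂μ)⁻¹ • (⟨f, hfc⟩ : C_c(G, ℝ)), fun r => ?_, fun r hr => ?_, ?_⟩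
    · exact mul_nonneg (inv_nonneg.2 hpos.le) (hf01 r).1
    · exact mul_eq_zero_of_right _ (hf0 fun h => hr (interior_subset h))
    · exact (integral_const_mul _ _).trans (inv_mul_cancel₀ hpos.ne')
  choose z h0 h1 h2 using key
  exact ⟨z, h0, h1, h2⟩

theorem exists_isBoundedNhdsBase (G : Type*) [TopologicalSpace G] [Group G]
    [LocallyCompactSpace G] : ∃ Z : Set (Set G), IsBoundedNhdsBase Z := by
  obtain ⟨K, hK, hK1⟩ := exists_compact_mem_nhds (1 : G)
  exact ⟨{V | V ∈ 𝓝 1 ∧ V ⊆ K}, fun V hV => hV.1,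
    fun N hN => ⟨N ∩ K, ⟨inter_mem hN hK1, Set.inter_subset_right⟩, Set.inter_subset_left⟩,
    K, hK, fun V hV => hV.2⟩

theorem CompactlySupportedContinuousMap.integrable_smul {E : Type*} [NormedAddCommGroup E]
    [NormedSpace ℝ E] (μ : Measure G) [IsFiniteMeasureOnCompacts μ] (z : C_c(G, ℝ)) {φ : G → E}
    (hφ : Continuous φ) : Integrable (fun r => z r • φ r) μ :=
  (z.continuous.smul hφ).integrable_of_hasCompactSupport z.hasCompactSupport.smul_right

/-- Since z_q has total mass one, the error is the average of φ_q(r) - y, which is small on N, and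
z_q eventually has no mass elsewhere. The functions φ_q vary with q because in the applications they
carry an element of a net in `A`. -/
theorem IsDeltaNet.tendsto_integral_smul {E : Type*} [NormedAddCommGroup E] [NormedSpace ℝ E]
    [CompleteSpace E] {μ : Measure G} [IsFiniteMeasureOnCompacts μ] {Q : Type*} {l : Filter Q}
    {z : Q → C_c(G, ℝ)} (hz : IsDeltaNet μ l z) {φ : Q → G → E} {y : E}
    (hφ : ∀ q, Continuous (φ q))
    (h : ∀ ε : ℝ, 0 < ε → ∃ N ∈ 𝓝 (1 : G), ∀ᶠ q in l, ∀ r ∈ N, ‖φ q r - y‖ ≤ ε) :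
    Tendsto (fun q => ∫ r, z q r • φ q r ∂μ) l (𝓝 y) := by
  rw [Metric.tendsto_nhds]
  intro ε hε
  obtain ⟨N, hN, hNε⟩ := h (ε / 2) (half_pos hε)
  filter_upwards [hNε, hz.eventually_eq_zero N hN] with q hq hq0
  have hi : Integrable (z q) μ :=
    (z q).continuous.integrable_of_hasCompactSupport (z q).hasCompactSupport
  have h1 : ∫ r, z q r • φ q r ∂μ - y = ∫ r, z q r • (φ q r - y) ∂μ := by
    simp only [smul_sub]
    rw [integral_sub ((z q).integrable_smul μ (hφ q)) (hi.smul_const y), integral_smul_const,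
      hz.integral_eq_one, one_smul]
  rw [dist_eq_norm, h1]
  refine (norm_integral_le_of_norm_le (hi.mul_const (ε / 2))
    (Eventually.of_forall fun r => ?_)).trans_lt ?_
  · rw [norm_smul, Real.norm_of_nonneg (hz.nonneg q r)]
    by_cases hr : r ∈ N
    · exact mul_le_mul_of_nonneg_left (hq r hr) (hz.nonneg q r)
    · simp [hq0 r hr]
  · rw [integral_mul_const, hz.integral_eq_one, one_mul]
    exact half_lt_self hε

/-- The norm of `z ⊗ a` in `L¹(G, A, ω)` for a probability density `z`. -/
theorem norm_toWeightedL1_tensorCc_le {A : Type*} [NormedAddCommGroup A] [NormedSpace ℝ A]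
    (ω : GroupWeight G) (μ : Measure G) [IsFiniteMeasureOnCompacts μ] {z : C_c(G, ℝ)}
    (h0 : ∀ r, 0 ≤ z r) (h1 : ∫ r, z r ∂μ = 1) {C : ℝ} (hC : ∀ r, z r ≠ 0 → ω r ≤ C) (a : A) :
    ‖toWeightedL1 ω μ (tensorCc z a)‖ ≤ C * ‖a‖ := by
  have hi : Integrable z μ := z.continuous.integrable_of_hasCompactSupport z.hasCompactSupport
  calc ‖toWeightedL1 ω μ (tensorCc z a)‖ = ∫ s, ‖z s • a‖ * ω s ∂μ := norm_toWeightedL1 ω μ _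
    _ ≤ ∫ s, z s * (C * ‖a‖) ∂μ := by
        refine integral_mono (integrable_norm_mul_weight ω μ (tensorCc z a))
          (hi.mul_const _) fun s => ?_
        simp only [norm_smul, Real.norm_of_nonneg (h0 s)]
        by_cases hs : z s = 0
        · simp [hs]
        · have := mul_le_mul_of_nonneg_left (hC s hs) (mul_nonneg (h0 s) (norm_nonneg a))
          linarith
    _ = C * ‖a‖ := by rw [integral_mul_const, h1, one_mul]

end Averages

end
noncomputable section

/-! ### Pointwise multiplication and twisted translation on the Beurling algebra -/

theorem GroupWeight.eventually_le {G : Type*} [Group G] [TopologicalSpace G] [IsTopologicalGroup G]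
    [T2Space G] [LocallyCompactSpace G] [MeasurableSpace G] [BorelSpace G] (ω : GroupWeight G)
    (r₀ : G) : ∃ C : ℝ, 0 ≤ C ∧ ∀ᶠ r in 𝓝 r₀, (ω r : ℝ) ≤ C := by
  obtain ⟨K, hK, hK0⟩ := exists_compact_mem_nhds r₀
  obtain ⟨C, hC⟩ := ω.exists_bound_of_isCompact hK
  exact ⟨C, C.2, by filter_upwards [hK0] with r hr; exact_mod_cast hC r hr⟩

section Operators

variable {𝕜 : Type*} [RCLike 𝕜]
  {G : Type*} [Group G] [TopologicalSpace G] [IsTopologicalGroup G] [T2Space G]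
  [LocallyCompactSpace G] [MeasurableSpace G] [BorelSpace G]
  {A : Type*} [NonUnitalNormedRing A] [NormedSpace 𝕜 A] [IsScalarTower 𝕜 A A]
  [SMulCommClass 𝕜 A A] [CompleteSpace A] [NormedSpace ℝ A] [IsScalarTower ℝ 𝕜 A]

variable (𝕜) in
/-- Pointwise left multiplication by `b` on `C_c(G, A)`. -/
def leftMulCc (b : A) : C_c(G, A) →ₗ[𝕜] C_c(G, A) where
  toFun f := ⟨⟨fun s => b * f s, continuous_const.mul f.continuous⟩, f.hasCompactSupport.mul_left⟩
  map_add' _ _ := CompactlySupportedContinuousMap.ext fun _ => mul_add _ _ _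
  map_smul' _ _ := CompactlySupportedContinuousMap.ext fun _ => mul_smul_comm _ _ _

@[simp]
theorem leftMulCc_apply (b : A) (f : C_c(G, A)) (s : G) : leftMulCc 𝕜 b f s = b * f s := rfl

/-- The twisted translation `(Λ_s f)(r) = α_s(f(s⁻¹ r))` on `C_c(G, A)`. -/
def translateCc (α : BanachAlgebraAction 𝕜 G A) (s : G) : C_c(G, A) →ₗ[𝕜] C_c(G, A) where
  toFun f := ⟨⟨fun r => α s (f (s⁻¹ * r)), (α s).continuous.comp
    (f.continuous.comp (continuous_const.mul continuous_id))⟩,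
    (f.hasCompactSupport.comp_homeomorph (Homeomorph.mulLeft s⁻¹)).comp_left (map_zero (α s))⟩
  map_add' _ _ := CompactlySupportedContinuousMap.ext fun _ => map_add (α s) _ _
  map_smul' _ _ := CompactlySupportedContinuousMap.ext fun _ => map_smul (α s) _ _

@[simp]
theorem translateCc_apply (α : BanachAlgebraAction 𝕜 G A) (s : G) (f : C_c(G, A)) (r : G) :
    translateCc α s f r = α s (f (s⁻¹ * r)) := rfl

variable (ω : GroupWeight G) (μ : Measure G) [μ.IsHaarMeasure]

theorem norm_toWeightedL1_leftMulCc_le (b : A) (f : C_c(G, A)) :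
    ‖toWeightedL1 ω μ (leftMulCc 𝕜 b f)‖ ≤ ‖b‖ * ‖toWeightedL1 ω μ f‖ := by
  rw [norm_toWeightedL1, norm_toWeightedL1, ← integral_const_mul]
  refine integral_mono (integrable_norm_mul_weight ω μ (leftMulCc 𝕜 b f))
    ((integrable_norm_mul_weight ω μ f).const_mul _) fun s => ?_
  calc ‖b * f s‖ * ω s ≤ ‖b‖ * ‖f s‖ * ω s := by gcongr; exact norm_mul_le _ _
    _ = ‖b‖ * (‖f s‖ * ω s) := mul_assoc _ _ _

/-- Left invariance moves the translation from f to the weight, where ω(sr) ≤ ω(s)ω(r) applies. -/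
theorem norm_toWeightedL1_translateCc_le (α : BanachAlgebraAction 𝕜 G A) (s : G)
    (f : C_c(G, A)) :
    ‖toWeightedL1 ω μ (translateCc α s f)‖ ≤ ‖α s‖ * ω s * ‖toWeightedL1 ω μ f‖ := by
  rw [norm_toWeightedL1, norm_toWeightedL1, ← integral_const_mul,
    ← integral_mul_left_eq_self _ s]
  refine integral_mono_of_nonneg (Eventually.of_forall fun s => by positivity)
    ((integrable_norm_mul_weight ω μ f).const_mul _) (Eventually.of_forall fun r => ?_)
  have h1 : (ω (s * r) : ℝ) ≤ ω s * ω r := by exact_mod_cast ω.submul' s r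
  simp only [translateCc_apply, inv_mul_cancel_left]
  calc ‖α s (f r)‖ * ω (s * r) ≤ ‖α s‖ * ‖f r‖ * (ω s * ω r) := by
        gcongr; exact (α s).le_opNorm _
    _ = ‖α s‖ * ω s * (‖f r‖ * ω r) := by ring

variable (𝕜) in
/-- Left multiplication by `b ∈ A` on `L¹(G, A, ω)`. -/
def leftMulL1 (b : A) : WeightedL1 A ω μ →L[𝕜] WeightedL1 A ω μ :=
  (toWeightedL1Lin 𝕜 ω μ ∘ₗ leftMulCc 𝕜 b).extendOfNorm (toWeightedL1Lin 𝕜 ω μ)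

@[simp]
theorem leftMulL1_coe (b : A) (f : C_c(G, A)) :
    leftMulL1 𝕜 ω μ b (toWeightedL1 ω μ f) = toWeightedL1 ω μ (leftMulCc 𝕜 b f) :=
  LinearMap.extendOfNorm_eq (denseRange_toWeightedL1 A ω μ)
    ⟨‖b‖, norm_toWeightedL1_leftMulCc_le ω μ b⟩ f

theorem norm_leftMulL1_le (b : A) : ‖leftMulL1 𝕜 ω μ b‖ ≤ ‖b‖ :=
  ContinuousLinearMap.opNorm_le_bound _ (norm_nonneg b)
    (LinearMap.norm_extendOfNorm_apply_le (denseRange_toWeightedL1 A ω μ) _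
      (norm_toWeightedL1_leftMulCc_le ω μ b))

/-- The twisted translation by `s ∈ G` on `L¹(G, A, ω)`. -/
def translateL1 (α : BanachAlgebraAction 𝕜 G A) (s : G) :
    WeightedL1 A ω μ →L[𝕜] WeightedL1 A ω μ :=
  (toWeightedL1Lin 𝕜 ω μ ∘ₗ translateCc α s).extendOfNorm (toWeightedL1Lin 𝕜 ω μ)

@[simp]
theorem translateL1_coe (α : BanachAlgebraAction 𝕜 G A) (s : G) (f : C_c(G, A)) :
    translateL1 ω μ α s (toWeightedL1 ω μ f) = toWeightedL1 ω μ (translateCc α s f) :=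
  LinearMap.extendOfNorm_eq (denseRange_toWeightedL1 A ω μ)
    ⟨‖α s‖ * ω s, norm_toWeightedL1_translateCc_le ω μ α s⟩ f

theorem norm_translateL1_le (α : BanachAlgebraAction 𝕜 G A) (s : G) :
    ‖translateL1 ω μ α s‖ ≤ ‖α s‖ * ω s :=
  ContinuousLinearMap.opNorm_le_bound _ (by positivity)
    (LinearMap.norm_extendOfNorm_apply_le (denseRange_toWeightedL1 A ω μ) _
      (norm_toWeightedL1_translateCc_le ω μ α s))

/-! Algebraic relations. -/

theorem leftMulL1_add (a b : A) :
    leftMulL1 𝕜 ω μ (a + b) = leftMulL1 𝕜 ω μ a + leftMulL1 𝕜 ω μ b := by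
  refine WeightedL1.ext_clm ω μ fun f => ?_
  rw [add_apply, leftMulL1_coe, leftMulL1_coe, leftMulL1_coe,
    ← toWeightedL1Lin_apply (𝕜 := 𝕜), ← toWeightedL1Lin_apply (𝕜 := 𝕜),
    ← toWeightedL1Lin_apply (𝕜 := 𝕜), ← map_add]
  exact congrArg _ (CompactlySupportedContinuousMap.ext fun s => add_mul _ _ _)

theorem leftMulL1_smul (c : 𝕜) (a : A) :
    leftMulL1 𝕜 ω μ (c • a) = c • leftMulL1 𝕜 ω μ a := by
  refine WeightedL1.ext_clm ω μ fun f => ?_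
  rw [smul_apply, leftMulL1_coe, leftMulL1_coe,
    ← toWeightedL1Lin_apply (𝕜 := 𝕜), ← toWeightedL1Lin_apply (𝕜 := 𝕜), ← map_smul]
  exact congrArg _ (CompactlySupportedContinuousMap.ext fun s => smul_mul_assoc _ _ _)

theorem leftMulL1_mul (a b : A) :
    leftMulL1 𝕜 ω μ (a * b) = leftMulL1 𝕜 ω μ a ∘L leftMulL1 𝕜 ω μ b := by
  refine WeightedL1.ext_clm ω μ fun f => ?_
  rw [ContinuousLinearMap.comp_apply, leftMulL1_coe, leftMulL1_coe, leftMulL1_coe]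
  exact congrArg _ (CompactlySupportedContinuousMap.ext fun s => mul_assoc _ _ _)

theorem translateL1_one (α : BanachAlgebraAction 𝕜 G A) :
    translateL1 ω μ α 1 = ContinuousLinearMap.id 𝕜 _ := by
  refine WeightedL1.ext_clm ω μ fun f => ?_
  rw [translateL1_coe]
  exact congrArg _ (CompactlySupportedContinuousMap.ext fun s => by simp)

theorem translateL1_mul (α : BanachAlgebraAction 𝕜 G A) (s t : G) :
    translateL1 ω μ α (s * t) = translateL1 ω μ α s ∘L translateL1 ω μ α t := by
  refine WeightedL1.ext_clm ω μ fun f => ?_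
  rw [ContinuousLinearMap.comp_apply, translateL1_coe, translateL1_coe, translateL1_coe]
  exact congrArg _ (CompactlySupportedContinuousMap.ext fun r => by simp [mul_assoc])

/-- Follows from α_s being multiplicative; T transports it to the covariance relation for (π,U). -/
theorem translateL1_comp_leftMulL1 (α : BanachAlgebraAction 𝕜 G A) (s : G) (a : A) :
    translateL1 ω μ α s ∘L leftMulL1 𝕜 ω μ a =
      leftMulL1 𝕜 ω μ (α s a) ∘L translateL1 ω μ α s := by
  refine WeightedL1.ext_clm ω μ fun f => ?_
  rw [ContinuousLinearMap.comp_apply, ContinuousLinearMap.comp_apply, translateL1_coe,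
    leftMulL1_coe, leftMulL1_coe, translateL1_coe]
  exact congrArg _ (CompactlySupportedContinuousMap.ext fun r => by simp [α.map_mul'])

/-! Compatibility with the twisted convolution. -/

/-- The constant left factor enters the integral by associativity. Together with the analogue for
translations this is the left centralizer property. -/
theorem leftMulCc_twistedConv (α : BanachAlgebraAction 𝕜 G A) (a : A) (f g : C_c(G, A)) :
    leftMulCc 𝕜 a (twistedConv μ α f g) = twistedConv μ α (leftMulCc 𝕜 a f) g := by
  refine CompactlySupportedContinuousMap.ext fun s => ?_
  refine ((ContinuousLinearMap.mul 𝕜 A a).integral_comp_comm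
    (twistedConv_integrable μ α f g s)).symm.trans ?_
  exact congrArg (fun F : G → A => ∫ r, F r ∂μ) (funext fun r => (mul_assoc _ _ _).symm)

/-- After α_s is moved inside the integral, the substitution r ↦ sr, allowed by left invariance,
identifies the two sides. -/
theorem translateCc_twistedConv (α : BanachAlgebraAction 𝕜 G A) (s : G) (f g : C_c(G, A)) :
    translateCc α s (twistedConv μ α f g) = twistedConv μ α (translateCc α s f) g := by
  refine CompactlySupportedContinuousMap.ext fun t => ?_
  refine ((α s).integral_comp_comm (twistedConv_integrable μ α f g (s⁻¹ * t))).symm.trans ?_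
  refine Eq.trans ?_ (integral_mul_left_eq_self
    (fun r => translateCc α s f r * α r (g (r⁻¹ * t))) s)
  exact congrArg (fun F : G → A => ∫ r, F r ∂μ) (funext fun r => by simp [α.map_mul', mul_assoc])

variable (α : BanachAlgebraAction 𝕜 G A) (hα : α.UniformlyBounded)

theorem continuous_beurlingMul :
    Continuous fun p : WeightedL1 A ω μ × WeightedL1 A ω μ => beurlingMul α hα ω μ p.1 p.2 :=
  (beurlingMul α hα ω μ).continuous₂

theorem leftMulL1_beurlingMul (a : A) (u v : WeightedL1 A ω μ) :
    leftMulL1 𝕜 ω μ a (beurlingMul α hα ω μ u v) =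
      beurlingMul α hα ω μ (leftMulL1 𝕜 ω μ a u) v := by
  refine (denseRange_toWeightedL1 A ω μ).induction_on₂ (p := fun u v =>
    leftMulL1 𝕜 ω μ a (beurlingMul α hα ω μ u v) =
      beurlingMul α hα ω μ (leftMulL1 𝕜 ω μ a u) v) ?_ (fun f g => ?_) u v
  · exact isClosed_eq ((leftMulL1 𝕜 ω μ a).continuous.comp (continuous_beurlingMul ω μ α hα))
      ((continuous_beurlingMul ω μ α hα).comp
        (((leftMulL1 𝕜 ω μ a).continuous.comp continuous_fst).prodMk continuous_snd))
  · rw [beurlingMul_coe, leftMulL1_coe, leftMulL1_coe, beurlingMul_coe, leftMulCc_twistedConv]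

theorem translateL1_beurlingMul (s : G) (u v : WeightedL1 A ω μ) :
    translateL1 ω μ α s (beurlingMul α hα ω μ u v) =
      beurlingMul α hα ω μ (translateL1 ω μ α s u) v := by
  refine (denseRange_toWeightedL1 A ω μ).induction_on₂ (p := fun u v =>
    translateL1 ω μ α s (beurlingMul α hα ω μ u v) =
      beurlingMul α hα ω μ (translateL1 ω μ α s u) v) ?_ (fun f g => ?_) u v
  · exact isClosed_eq ((translateL1 ω μ α s).continuous.comp (continuous_beurlingMul ω μ α hα))
      ((continuous_beurlingMul ω μ α hα).comp
        (((translateL1 ω μ α s).continuous.comp continuous_fst).prodMk continuous_snd))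
  · rw [beurlingMul_coe, translateL1_coe, translateL1_coe, beurlingMul_coe,
      translateCc_twistedConv]

/-! Continuity. -/

/-- For r in a compact neighbourhood K of r₀ all translates are supported in K · supp f, so joint
continuity of the action gives uniform, hence weighted, convergence. -/
theorem continuous_translateL1_coe (f : C_c(G, A)) :
    Continuous fun r => translateL1 ω μ α r (toWeightedL1 ω μ f) := by
  simp only [translateL1_coe]
  refine continuous_iff_continuousAt.2 fun r₀ => ?_
  obtain ⟨K, hK, hK0⟩ := exists_compact_mem_nhds r₀
  refine continuousAt_toWeightedL1 ω μ (α.continuous_uncurry.comp (continuous_fst.prodMk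
    (f.continuous.comp (continuous_fst.inv.mul continuous_snd))))
    (hK.mul f.hasCompactSupport.isCompact) ?_
  filter_upwards [hK0] with r hr s hs
  have : r⁻¹ * s ∉ tsupport f := fun h => hs (Set.mem_mul.2 ⟨r, hr, r⁻¹ * s, h, by group⟩)
  rw [translateCc_apply, image_eq_zero_of_notMem_tsupport this, map_zero]

theorem dense_span_range_toWeightedL1 :
    Dense (Submodule.span 𝕜 (Set.range (toWeightedL1 (A := A) ω μ)) : Set (WeightedL1 A ω μ)) :=
  (denseRange_toWeightedL1 A ω μ).mono Submodule.subset_span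

/-- A weight is locally bounded, so ‖Λ_r‖ is bounded near each r₀ and continuity extends from the
dense subspace `C_c(G, A)`. -/
theorem continuous_translateL1 (hα : α.UniformlyBounded) (u : WeightedL1 A ω μ) :
    Continuous fun r => translateL1 ω μ α r u := by
  obtain ⟨C, hC⟩ := hα
  refine continuous_iff_continuousAt.2 fun r₀ => ?_
  obtain ⟨M, hM0, hM⟩ := ω.eventually_le r₀
  refine tendsto_apply_of_dense_span (S := fun r => translateL1 ω μ α r)
    (S₀ := translateL1 ω μ α r₀) (κ := C * M) ?_
    (dense_span_range_toWeightedL1 (𝕜 := 𝕜) ω μ) ?_ u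
  · filter_upwards [hM] with r hr
    exact (norm_translateL1_le ω μ α r).trans
      (mul_le_mul (hC r) hr (NNReal.coe_nonneg _) ((norm_nonneg _).trans (hC r)))
  · rintro _ ⟨f, rfl⟩
    exact (continuous_translateL1_coe ω μ α f).continuousAt

/-- The uniform bound κ spreads the estimate at a₀ to a ball around a₀, and finitely many such balls
cover K. It is applied to the compact range of a function in `C_c(G, A)`. -/
theorem eventually_norm_mul_sub_le {Q : Type*} {l : Filter Q} {u : Q → A} {κ : ℝ}
    (hb : ∀ q, ‖u q‖ ≤ κ) (hu : ∀ a, Tendsto (fun q => u q * a) l (𝓝 a)) {K : Set A}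
    (hK : IsCompact K) {ε : ℝ} (hε : 0 < ε) : ∀ᶠ q in l, ∀ a ∈ K, ‖u q * a - a‖ ≤ ε := by
  refine hK.induction_on (p := fun S => ∀ᶠ q in l, ∀ a ∈ S, ‖u q * a - a‖ ≤ ε) (by simp)
    (fun s t hst h => h.mono fun q hq a ha => hq a (hst ha))
    (fun s t hs ht => by
      filter_upwards [hs, ht] with q hq hq' a ha
      exact ha.elim (hq a) (hq' a)) fun a₀ _ => ?_
  refine ⟨Metric.ball a₀ (ε / (2 * (|κ| + 1))),
    mem_nhdsWithin_of_mem_nhds (Metric.ball_mem_nhds _ (by positivity)), ?_⟩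
  filter_upwards [Metric.tendsto_nhds.1 (hu a₀) (ε / 2) (half_pos hε)] with q hq a ha
  rw [mem_ball_iff_norm, lt_div_iff₀ (by positivity)] at ha
  rw [dist_eq_norm] at hq
  have h1 : ‖u q * (a - a₀)‖ ≤ |κ| * ‖a - a₀‖ :=
    (norm_mul_le _ _).trans (by gcongr; exact (hb q).trans (le_abs_self κ))
  have h2 : u q * a - a = u q * (a - a₀) + (u q * a₀ - a₀) - (a - a₀) := by
    rw [mul_sub]; abel
  rw [h2]
  have h3 := norm_sub_le (u q * (a - a₀) + (u q * a₀ - a₀)) (a - a₀)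
  have h4 := norm_add_le (u q * (a - a₀)) (u q * a₀ - a₀)
  nlinarith [norm_nonneg (a - a₀)]

theorem tendsto_leftMulL1 {Q : Type*} {l : Filter Q} {u : Q → A} {κ : ℝ}
    (hb : ∀ q, ‖u q‖ ≤ κ) (hu : ∀ a, Tendsto (fun q => u q * a) l (𝓝 a))
    (v : WeightedL1 A ω μ) : Tendsto (fun q => leftMulL1 𝕜 ω μ (u q) v) l (𝓝 v) := by
  refine tendsto_apply_of_dense_span (S := fun q => leftMulL1 𝕜 ω μ (u q))
    (S₀ := ContinuousLinearMap.id 𝕜 _) (κ := κ)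
    (Eventually.of_forall fun q => (norm_leftMulL1_le ω μ _).trans (hb q))
    (dense_span_range_toWeightedL1 (𝕜 := 𝕜) ω μ) ?_ v
  rintro _ ⟨f, rfl⟩
  simp only [leftMulL1_coe]
  refine tendsto_toWeightedL1 ω μ f.hasCompactSupport.isCompact
    (Eventually.of_forall fun q s hs => ?_) (fun s hs => image_eq_zero_of_notMem_tsupport hs)
    fun ε hε => ?_
  · rw [leftMulCc_apply, image_eq_zero_of_notMem_tsupport hs, mul_zero]
  · filter_upwards [eventually_norm_mul_sub_le hb hu
      (f.hasCompactSupport.isCompact_range f.continuous) hε] with q hq s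
    exact hq _ ⟨s, rfl⟩

/-! The twisted convolution as a Bochner integral. -/

theorem integrable_leftMulL1_translateL1 (f g : C_c(G, A)) :
    Integrable (fun r => leftMulL1 𝕜 ω μ (f r) (translateL1 ω μ α r (toWeightedL1 ω μ g))) μ := by
  simp only [translateL1_coe, leftMulL1_coe]
  refine Continuous.integrable_of_hasCompactSupport ?_
    (HasCompactSupport.intro f.hasCompactSupport.isCompact fun r hr => ?_)
  · refine continuous_iff_continuousAt.2 fun r₀ => continuousAt_toWeightedL1 ω μ
      ((twistedConv_integrand_continuous α f g).comp continuous_swap)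
      (f.hasCompactSupport.isCompact.mul g.hasCompactSupport.isCompact)
      (Eventually.of_forall fun r s hs => twistedConv_integrand_eq_zero α f g s r fun h => hs h.2)
  · rw [← map_zero (toWeightedL1Lin 𝕜 ω μ (A := A)), toWeightedL1Lin_apply]
    exact congrArg _ (CompactlySupportedContinuousMap.ext fun s =>
      twistedConv_integrand_eq_zero α f g s r fun h => hr h.1)

/-- The integrand of the convolution at s is the value at s of f(r) · Λ_r g. The pointwise formula
thus becomes an identity of vectors in L¹, to which bounded operators can be applied. -/
theorem beurlingMul_coe_eq_integral (f g : C_c(G, A)) :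
    beurlingMul α hα ω μ (toWeightedL1 ω μ f) (toWeightedL1 ω μ g) =
      ∫ r, leftMulL1 𝕜 ω μ (f r) (translateL1 ω μ α r (toWeightedL1 ω μ g)) ∂μ := by
  simp only [translateL1_coe, leftMulL1_coe]
  rw [beurlingMul_coe]
  exact toWeightedL1_eq_integral ω μ f.hasCompactSupport.isCompact
    (f.hasCompactSupport.isCompact.mul g.hasCompactSupport.isCompact)
    ((twistedConv_integrand_continuous α f g).comp continuous_swap)
    (fun r hr s => twistedConv_integrand_eq_zero α f g s r fun h => hr h.1)
    (fun r s hs => twistedConv_integrand_eq_zero α f g s r fun h => hs h.2) fun s => rfl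

/-- `z_q ⊗ u_q` is a left approximate identity. -/
theorem tendsto_beurlingMul_tensorCc {Q : Type*} {l : Filter Q} {z : Q → C_c(G, ℝ)}
    (hz : IsDeltaNet μ l z) {u : Q → A} {κ : ℝ} (hb : ∀ q, ‖u q‖ ≤ κ)
    (hu : ∀ a, Tendsto (fun q => u q * a) l (𝓝 a)) (g : C_c(G, A)) :
    Tendsto (fun q => beurlingMul α hα ω μ (toWeightedL1 ω μ (tensorCc (z q) (u q)))
      (toWeightedL1 ω μ g)) l (𝓝 (toWeightedL1 ω μ g)) := by
  set v := toWeightedL1 ω μ g with hv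
  have hint : ∀ q, beurlingMul α hα ω μ (toWeightedL1 ω μ (tensorCc (z q) (u q))) v =
      ∫ r, z q r • leftMulL1 𝕜 ω μ (u q) (translateL1 ω μ α r v) ∂μ := by
    intro q
    rw [hv, beurlingMul_coe_eq_integral]
    refine integral_congr_ae (Eventually.of_forall fun r => ?_)
    change leftMulL1 𝕜 ω μ (z q r • u q) _ = _
    rw [RCLike.real_smul_eq_coe_smul (K := 𝕜), leftMulL1_smul, smul_apply,
      ← RCLike.real_smul_eq_coe_smul (K := 𝕜)]
  simp only [hint]
  refine hz.tendsto_integral_smul (fun q => (leftMulL1 𝕜 ω μ (u q)).continuous.comp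
    (continuous_translateL1 ω μ α hα v)) fun ε hε => ?_
  -- Here translation moves v so little that left multiplication by u_q, of norm at most |κ|, keeps
  -- the error below ε/2 for all q at once.
  refine ⟨{r | ‖translateL1 ω μ α r v - v‖ < ε / (2 * (|κ| + 1))}, ?_, ?_⟩
  · have hc : Continuous fun r => ‖translateL1 ω μ α r v - v‖ :=
      ((continuous_translateL1 ω μ α hα v).sub continuous_const).norm
    refine hc.continuousAt.eventually_lt_const ?_
    simp only [translateL1_one, ContinuousLinearMap.id_apply, sub_self, norm_zero]
    positivity
  · filter_upwards [Metric.tendsto_nhds.1 (tendsto_leftMulL1 (𝕜 := 𝕜) ω μ hb hu v) (ε / 2)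
      (half_pos hε)] with q hq r hr
    rw [dist_eq_norm] at hq
    have hr' : ‖translateL1 ω μ α r v - v‖ < ε / (2 * (|κ| + 1)) := hr
    rw [lt_div_iff₀ (by positivity)] at hr'
    have h1 : ‖leftMulL1 𝕜 ω μ (u q) (translateL1 ω μ α r v - v)‖ ≤
        |κ| * ‖translateL1 ω μ α r v - v‖ :=
      (ContinuousLinearMap.le_opNorm _ _).trans (by
        gcongr
        exact ((norm_leftMulL1_le ω μ _).trans (hb q)).trans (le_abs_self κ))
    have h2 : leftMulL1 𝕜 ω μ (u q) (translateL1 ω μ α r v) - v =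
        leftMulL1 𝕜 ω μ (u q) (translateL1 ω μ α r v - v) + (leftMulL1 𝕜 ω μ (u q) v - v) := by
      rw [map_sub]; abel
    rw [h2]
    have h3 := norm_add_le (leftMulL1 𝕜 ω μ (u q) (translateL1 ω μ α r v - v))
      (leftMulL1 𝕜 ω μ (u q) v - v)
    nlinarith [norm_nonneg (translateL1 ω μ α r v - v)]

end Operators

end
noncomputable section

/-! ### The integrated form of a covariant representation -/

section IntegratedForm

variable {𝕜 : Type*} [RCLike 𝕜]
  {G : Type*} [Group G] [TopologicalSpace G] [IsTopologicalGroup G] [T2Space G]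
  [LocallyCompactSpace G] [MeasurableSpace G] [BorelSpace G]
  {A : Type*} [NonUnitalNormedRing A] [NormedSpace 𝕜 A] [IsScalarTower 𝕜 A A]
  [SMulCommClass 𝕜 A A] [CompleteSpace A] [NormedSpace ℝ A] [IsScalarTower ℝ 𝕜 A]
  {X : Type*} [NormedAddCommGroup X] [NormedSpace 𝕜 X] [CompleteSpace X]
  [NormedSpace ℝ X] [IsScalarTower ℝ 𝕜 X]
  {α : BanachAlgebraAction 𝕜 G A} (p : ContinuousCovariantRep α X)

theorem ContinuousCovariantRep.continuous_integrand {f : G → A} (hf : Continuous f) (x : X) :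
    Continuous fun r => p.π (f r) (p.U r x) :=
  (p.π.continuous.comp hf).clm_apply (p.U_continuous x)

theorem ContinuousCovariantRep.integrable_integrand (μ : Measure G)
    [IsFiniteMeasureOnCompacts μ] (f : C_c(G, A)) (x : X) :
    Integrable (fun r => p.π (f r) (p.U r x)) μ :=
  (p.continuous_integrand f.continuous x).integrable_of_hasCompactSupport
    (HasCompactSupport.intro f.hasCompactSupport.isCompact fun r hr => by
      have h0 : f.toContinuousMap r = 0 := image_eq_zero_of_notMem_tsupport hr
      simp [h0])

/-- The integral `∫ π(f(r)) U_r x dr` as a bilinear map. -/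
def ContinuousCovariantRep.integralLin (μ : Measure G) [IsFiniteMeasureOnCompacts μ] :
    C_c(G, A) →ₗ[𝕜] X →ₗ[𝕜] X :=
  LinearMap.mk₂ 𝕜 (fun f x => ∫ r, p.π (f r) (p.U r x) ∂μ)
    (fun f f' x => by
      rw [← integral_add (p.integrable_integrand μ f x) (p.integrable_integrand μ f' x)]
      simp)
    (fun c f x => by
      rw [← integral_smul]
      simp)
    (fun f x x' => by
      rw [← integral_add (p.integrable_integrand μ f x) (p.integrable_integrand μ f x')]
      simp)
    (fun c f x => by
      rw [← integral_smul]
      simp)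

theorem ContinuousCovariantRep.norm_integralLin_le (ω : GroupWeight G) (μ : Measure G)
    [IsFiniteMeasureOnCompacts μ] {C : ℝ} (hC : ∀ r, ‖p.U r‖ ≤ C * ω r) (f : C_c(G, A)) (x : X) :
    ‖p.integralLin μ f x‖ ≤ C * ‖p.π‖ * ‖toWeightedL1 ω μ f‖ * ‖x‖ := by
  have h1 : C * ‖p.π‖ * ‖toWeightedL1 ω μ f‖ * ‖x‖ =
      ∫ r, (C * ‖p.π‖ * ‖x‖) * (‖f r‖ * ω r) ∂μ := by
    rw [integral_const_mul, norm_toWeightedL1]; ring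
  rw [h1]
  refine norm_integral_le_of_norm_le ((integrable_norm_mul_weight ω μ f).const_mul _)
    (Eventually.of_forall fun r => ?_)
  calc ‖p.π (f r) (p.U r x)‖ ≤ (‖p.π‖ * ‖f r‖) * ((C * ω r) * ‖x‖) :=
        (ContinuousLinearMap.le_opNorm _ _).trans (mul_le_mul (p.π.le_opNorm _)
          (((p.U r).le_opNorm x).trans (by gcongr; exact hC r)) (norm_nonneg _) (by positivity))
    _ = (C * ‖p.π‖ * ‖x‖) * (‖f r‖ * ω r) := by ring

/-- `f ↦ ∫ π(f(r)) U_r dr` with values in the bounded operators. -/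
def ContinuousCovariantRep.integralClm (ω : GroupWeight G) (μ : Measure G)
    [IsFiniteMeasureOnCompacts μ] (hp : p.BoundedByWeight ω) : C_c(G, A) →ₗ[𝕜] X →L[𝕜] X where
  toFun f := (p.integralLin μ f).mkContinuous _
    (p.norm_integralLin_le ω μ hp.choose_spec.2 f)
  map_add' f f' := ContinuousLinearMap.ext fun x => by simp
  map_smul' c f := ContinuousLinearMap.ext fun x => by simp

/-- Every admissible C is allowed, not just the constant chosen in the construction; this freedom
gives the stated bound on the norm of the integrated form. -/
theorem ContinuousCovariantRep.norm_integralClm_le (ω : GroupWeight G) (μ : Measure G)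
    [IsFiniteMeasureOnCompacts μ] (hp : p.BoundedByWeight ω) {C : ℝ} (hC0 : 0 ≤ C)
    (hC : ∀ r, ‖p.U r‖ ≤ C * ω r) (f : C_c(G, A)) :
    ‖p.integralClm ω μ hp f‖ ≤ C * ‖p.π‖ * ‖toWeightedL1 ω μ f‖ :=
  ContinuousLinearMap.opNorm_le_bound _ (by positivity) (p.norm_integralLin_le ω μ hC f)

variable (hα : α.UniformlyBounded) (ω : GroupWeight G) (μ : Measure G) [μ.IsHaarMeasure]

/-- The extension of `f ↦ ∫ π(f(r)) U_r dr` to `L¹(G, A, ω)`. -/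
def ContinuousCovariantRep.integralL1 (hp : p.BoundedByWeight ω) :
    WeightedL1 A ω μ →L[𝕜] (X →L[𝕜] X) :=
  (p.integralClm ω μ hp).extendOfNorm (toWeightedL1Lin 𝕜 ω μ)

theorem ContinuousCovariantRep.integralL1_coe (hp : p.BoundedByWeight ω) (f : C_c(G, A)) (x : X) :
    p.integralL1 ω μ hp (toWeightedL1 ω μ f) x = ∫ r, p.π (f r) (p.U r x) ∂μ :=
  congrArg (fun S : X →L[𝕜] X => S x) (LinearMap.extendOfNorm_eq (denseRange_toWeightedL1 A ω μ)
    ⟨_, p.norm_integralClm_le ω μ hp hp.choose_spec.1 hp.choose_spec.2⟩ f)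

theorem ContinuousCovariantRep.norm_integralL1_le (hp : p.BoundedByWeight ω) {C : ℝ}
    (hC0 : 0 ≤ C) (hC : ∀ r, ‖p.U r‖ ≤ C * ω r) : ‖p.integralL1 ω μ hp‖ ≤ C * ‖p.π‖ :=
  ContinuousLinearMap.opNorm_le_bound _ (by positivity)
    (LinearMap.norm_extendOfNorm_apply_le (denseRange_toWeightedL1 A ω μ) _
      (p.norm_integralClm_le ω μ hp hC0 hC))

/-- On `C_c(G, A)`, π(a) passes under the integral and π(a)π(f(r)) = π(a f(r)); density does the
rest. -/
theorem ContinuousCovariantRep.π_integralL1 (hp : p.BoundedByWeight ω) (a : A)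
    (u : WeightedL1 A ω μ) (x : X) :
    p.π a (p.integralL1 ω μ hp u x) = p.integralL1 ω μ hp (leftMulL1 𝕜 ω μ a u) x := by
  have h : (ContinuousLinearMap.compL 𝕜 X X X (p.π a)) ∘L p.integralL1 ω μ hp =
      p.integralL1 ω μ hp ∘L leftMulL1 𝕜 ω μ a := by
    refine WeightedL1.ext_clm ω μ fun f => ContinuousLinearMap.ext fun x => ?_
    simp only [ContinuousLinearMap.comp_apply, ContinuousLinearMap.compL_apply, leftMulL1_coe,
      p.integralL1_coe]
    rw [← (p.π a).integral_comp_comm (p.integrable_integrand μ f x)]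
    simp [p.π_mul]
  exact congrArg (fun S => S u x) h

theorem ContinuousCovariantRep.U_π (s : G) (a : A) (x : X) :
    p.U s (p.π a x) = p.π (α s a) (p.U s x) := by
  rw [p.covariant, mul_apply_eq_comp, mul_apply_eq_comp,
    ← mul_apply_eq_comp (p.U s⁻¹), ← map_mul, inv_mul_cancel, map_one,
    one_apply_eq_self]

/-- Covariance gives U_s π(f(r)) U_r = π(α_s(f(r))) U_{sr}, and the substitution r ↦ s⁻¹r produces
the twisted translate. -/
theorem ContinuousCovariantRep.U_integralL1 (hp : p.BoundedByWeight ω) (s : G)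
    (u : WeightedL1 A ω μ) (x : X) :
    p.U s (p.integralL1 ω μ hp u x) = p.integralL1 ω μ hp (translateL1 ω μ α s u) x := by
  have h : (ContinuousLinearMap.compL 𝕜 X X X (p.U s)) ∘L p.integralL1 ω μ hp =
      p.integralL1 ω μ hp ∘L translateL1 ω μ α s := by
    refine WeightedL1.ext_clm ω μ fun f => ContinuousLinearMap.ext fun x => ?_
    simp only [ContinuousLinearMap.comp_apply, ContinuousLinearMap.compL_apply, translateL1_coe,
      p.integralL1_coe]
    rw [← (p.U s).integral_comp_comm (p.integrable_integrand μ f x),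
      ← integral_mul_left_eq_self (fun r => p.π (translateCc α s f r) (p.U r x)) s]
    simp [p.U_π]
  exact congrArg (fun S => S u x) h

/-- A bounded linear map on `L¹(G, A, ω)` that intertwines left multiplications and translations
with a pair `(π, U)` turns convolution into an integral over the pair. -/
theorem apply_beurlingMul_eq_integral {T : WeightedL1 A ω μ →L[𝕜] (X →L[𝕜] X)}
    (hπ : ∀ a u x, p.π a (T u x) = T (leftMulL1 𝕜 ω μ a u) x)
    (hU : ∀ s u x, p.U s (T u x) = T (translateL1 ω μ α s u) x) (f g : C_c(G, A)) (x : X) :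
    T (beurlingMul α hα ω μ (toWeightedL1 ω μ f) (toWeightedL1 ω μ g)) x =
      ∫ r, p.π (f r) (p.U r (T (toWeightedL1 ω μ g) x)) ∂μ := by
  rw [beurlingMul_coe_eq_integral]
  refine ((ContinuousLinearMap.apply 𝕜 X x ∘L T).integral_comp_comm
    (integrable_leftMulL1_translateL1 ω μ α f g)).symm.trans ?_
  simp [hπ, hU]

/-- The integrated form `T^{(π,U)}` of a covariant representation. -/
def ContinuousCovariantRep.integratedForm (hp : p.BoundedByWeight ω) :
    BeurlingRep α hα ω μ X where
  T := p.integralL1 ω μ hp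
  T_mul u v := by
    refine (denseRange_toWeightedL1 A ω μ).induction_on₂ (p := fun u v =>
      p.integralL1 ω μ hp (beurlingMul α hα ω μ u v) =
        p.integralL1 ω μ hp u * p.integralL1 ω μ hp v) ?_ (fun f g => ?_) u v
    · exact isClosed_eq ((p.integralL1 ω μ hp).continuous.comp (continuous_beurlingMul ω μ α hα))
        (((p.integralL1 ω μ hp).continuous.comp continuous_fst).mul
          ((p.integralL1 ω μ hp).continuous.comp continuous_snd))
    · refine ContinuousLinearMap.ext fun x => ?_
      -- The resulting integral is the defining formula for f evaluated at the vector T(g)x.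
      rw [apply_beurlingMul_eq_integral p hα ω μ (p.π_integralL1 ω μ hp) (p.U_integralL1 ω μ hp),
        mul_apply_eq_comp, p.integralL1_coe ω μ hp f]

theorem ContinuousCovariantRep.integratedForm_coe (hp : p.BoundedByWeight ω) (f : C_c(G, A))
    (x : X) : (p.integratedForm hα ω μ hp).T (toWeightedL1 ω μ f) x =
      ∫ r, p.π (f r) (p.U r x) ∂μ :=
  p.integralL1_coe ω μ hp f x

/-! Convergence of the integrated form along approximations of the point mass. -/

theorem ContinuousCovariantRep.integratedForm_tensorCc (hp : p.BoundedByWeight ω) (s : G)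
    (z : C_c(G, ℝ)) (b : A) (x : X) :
    (p.integratedForm hα ω μ hp).T (toWeightedL1 ω μ (tensorCc (leftTranslate s z) b)) x =
      ∫ r, z r • p.π b (p.U (s * r) x) ∂μ := by
  rw [p.integratedForm_coe, ← integral_mul_left_eq_self _ s]
  refine integral_congr_ae (Eventually.of_forall fun r => ?_)
  change p.π (z (s⁻¹ * (s * r)) • b) _ = _
  rw [inv_mul_cancel_left, RCLike.real_smul_eq_coe_smul (K := 𝕜), map_smul, smul_apply,
    ← RCLike.real_smul_eq_coe_smul (K := 𝕜)]

/-- Near r = e the averaged vector π(b_q)U_{sr}x stays close to π(b_q)U_s x, uniformly in q. Letting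
b_q vary covers both limit formulas, and a constant b_q gives non-degeneracy. -/
theorem ContinuousCovariantRep.tendsto_integratedForm_tensorCc (hp : p.BoundedByWeight ω) (s : G)
    {Q : Type*} {l : Filter Q} {z : Q → C_c(G, ℝ)} (hz : IsDeltaNet μ l z) {b : Q → A} {κ : ℝ}
    (hb : ∀ q, ‖b q‖ ≤ κ) {x y : X} (h : Tendsto (fun q => p.π (b q) (p.U s x)) l (𝓝 y)) :
    Tendsto (fun q => (p.integratedForm hα ω μ hp).T
      (toWeightedL1 ω μ (tensorCc (leftTranslate s (z q)) (b q))) x) l (𝓝 y) := by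
  simp only [p.integratedForm_tensorCc]
  have hUc : Continuous fun r => p.U (s * r) x :=
    (p.U_continuous x).comp (continuous_const.mul continuous_id)
  refine hz.tendsto_integral_smul (fun q => (p.π (b q)).continuous.comp hUc) fun ε hε => ?_
  refine ⟨{r | ‖p.U (s * r) x - p.U s x‖ < ε / (2 * (‖p.π‖ * |κ| + 1))}, ?_, ?_⟩
  · have hc : Continuous fun r => ‖p.U (s * r) x - p.U s x‖ := (hUc.sub continuous_const).norm
    refine hc.continuousAt.eventually_lt_const ?_
    simp only [mul_one, sub_self, norm_zero]
    positivity
  · filter_upwards [Metric.tendsto_nhds.1 h (ε / 2) (half_pos hε)] with q hq r hr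
    rw [dist_eq_norm] at hq
    have hr' : ‖p.U (s * r) x - p.U s x‖ < ε / (2 * (‖p.π‖ * |κ| + 1)) := hr
    rw [lt_div_iff₀ (by positivity)] at hr'
    have h1 : ‖p.π (b q) (p.U (s * r) x - p.U s x)‖ ≤
        (‖p.π‖ * |κ|) * ‖p.U (s * r) x - p.U s x‖ := by
      refine (ContinuousLinearMap.le_opNorm _ _).trans ?_
      gcongr
      exact (p.π.le_opNorm _).trans (by gcongr; exact (hb q).trans (le_abs_self κ))
    have h2 : p.π (b q) (p.U (s * r) x) - y =
        p.π (b q) (p.U (s * r) x - p.U s x) + (p.π (b q) (p.U s x) - y) := by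
      rw [map_sub]; abel
    rw [h2]
    have h3 := norm_add_le (p.π (b q) (p.U (s * r) x - p.U s x)) (p.π (b q) (p.U s x) - y)
    nlinarith [norm_nonneg (p.U (s * r) x - p.U s x)]

variable {p} in
-- On a vector π(a)x it reduces to π(u_q a)x → π(a)x; density and boundedness handle the remaining
-- vectors.
theorem ContinuousCovariantRep.Nondegenerate.tendsto_π (hp : p.Nondegenerate) {Q : Type*}
    {l : Filter Q} {u : Q → A} {κ : ℝ} (hb : ∀ q, ‖u q‖ ≤ κ)
    (hu : ∀ a, Tendsto (fun q => u q * a) l (𝓝 a)) (x : X) :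
    Tendsto (fun q => p.π (u q) x) l (𝓝 x) := by
  refine tendsto_apply_of_dense_span (S := fun q => p.π (u q))
    (S₀ := ContinuousLinearMap.id 𝕜 X) (κ := ‖p.π‖ * κ)
    (Eventually.of_forall fun q => (p.π.le_opNorm _).trans (by gcongr; exact hb q)) hp ?_ x
  rintro _ ⟨a, x, rfl⟩
  refine ((((ContinuousLinearMap.apply 𝕜 X x).comp p.π).continuous.tendsto a).comp
    (hu a)).congr fun q => ?_
  simp [p.π_mul]

theorem leftTranslate_one (z : C_c(G, ℝ)) : leftTranslate 1 z = z :=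
  CompactlySupportedContinuousMap.ext fun r => by simp [leftTranslate]

theorem dense_span_of_subset_closure {E : Type*} [NormedAddCommGroup E] [NormedSpace 𝕜 E]
    {D D' : Set E} (hD : Dense (Submodule.span 𝕜 D : Set E))
    (h : D ⊆ closure (Submodule.span 𝕜 D' : Set E)) :
    Dense (Submodule.span 𝕜 D' : Set E) := by
  have h1 : Submodule.span 𝕜 D ≤ (Submodule.span 𝕜 D').topologicalClosure :=
    Submodule.span_le.2 h
  exact dense_closure.1 (hD.mono h1)

variable {p} in
-- Each π(a)x is the limit of T(z_V ⊗ a)x. With a fixed, the second index is trivial, hence `Unit`.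
theorem ContinuousCovariantRep.Nondegenerate.integratedForm (hn : p.Nondegenerate)
    (hp : p.BoundedByWeight ω) : (p.integratedForm hα ω μ hp).Nondegenerate := by
  obtain ⟨Z, hZ⟩ := exists_isBoundedNhdsBase G
  obtain ⟨z, hz⟩ := hZ.exists_isApproxDelta μ
  have hδ := hz.isDeltaNet hZ (I := Unit)
  have := hZ.neBot_atTop (I := Unit)
  refine dense_span_of_subset_closure hn ?_
  rintro _ ⟨a, x, rfl⟩
  refine mem_closure_of_tendsto (p.tendsto_integratedForm_tensorCc hα ω μ hp 1 hδ
    (b := fun _ => a) (fun _ => le_rfl) (x := x) (y := p.π a x) ?_)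
    (Eventually.of_forall fun q => Submodule.subset_span ⟨_, x, rfl⟩)
  simp

end IntegratedForm

end
noncomputable section

/-! ### The covariant representation of a representation of the Beurling algebra -/

section Disintegration

variable {𝕜 : Type*} [RCLike 𝕜]
  {G : Type*} [Group G] [TopologicalSpace G] [IsTopologicalGroup G] [T2Space G]
  [LocallyCompactSpace G] [MeasurableSpace G] [BorelSpace G]
  {A : Type*} [NonUnitalNormedRing A] [NormedSpace 𝕜 A] [IsScalarTower 𝕜 A A]
  [SMulCommClass 𝕜 A A] [CompleteSpace A] [NormedSpace ℝ A] [IsScalarTower ℝ 𝕜 A]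
  {X : Type*} [NormedAddCommGroup X] [NormedSpace 𝕜 X] [CompleteSpace X]
  {α : BanachAlgebraAction 𝕜 G A} {hα : α.UniformlyBounded} {ω : GroupWeight G} {μ : Measure G}
  [μ.IsHaarMeasure]

/-- The representation operators applied to compactly supported functions already span a dense
subspace. -/
theorem BeurlingRep.Nondegenerate.dense_span_coe {T : BeurlingRep α hα ω μ X}
    (hT : T.Nondegenerate) :
    Dense (Submodule.span 𝕜 {y : X | ∃ (f : C_c(G, A)) (x : X),
      T.T (toWeightedL1 ω μ f) x = y} : Set X) := by
  refine dense_span_of_subset_closure hT ?_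
  rintro _ ⟨u, x, rfl⟩
  refine closure_mono Submodule.subset_span ?_
  have hc : Continuous fun u => T.T u x := T.T.continuous.clm_apply continuous_const
  exact (denseRange_toWeightedL1 A ω μ).induction_on (p := fun u => T.T u x ∈ closure
    {y : X | ∃ (f : C_c(G, A)) (x : X), T.T (toWeightedL1 ω μ f) x = y}) u
    (isClosed_closure.preimage hc) fun f => subset_closure ⟨f, x, rfl⟩

/-- A non-degenerate representation extends to the left centralizers of the Beurling algebra. -/
theorem BeurlingRep.Nondegenerate.exists_operator {T : BeurlingRep α hα ω μ X}
    (hT : T.Nondegenerate) {J : Type*} [Preorder J] [IsDirectedOrder J] [Nonempty J] {e : J → A}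
    (he : IsLeftApproxIdentity e) (he_bdd : ∃ K : ℝ, ∀ j, ‖e j‖ ≤ K) :
    ∃ κ : ℝ, 0 ≤ κ ∧ ∀ D : WeightedL1 A ω μ →L[𝕜] WeightedL1 A ω μ,
      (∀ u v, D (beurlingMul α hα ω μ u v) = beurlingMul α hα ω μ (D u) v) →
      ∃ S : X →L[𝕜] X, ‖S‖ ≤ κ * ‖D‖ ∧ ∀ u x, S (T.T u x) = T.T (D u) x := by
  obtain ⟨K, hK⟩ := he_bdd
  have hK0 : 0 ≤ K := (norm_nonneg _).trans (hK (Classical.arbitrary J))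
  obtain ⟨Z, hZ⟩ := exists_isBoundedNhdsBase G
  obtain ⟨z, hz⟩ := hZ.exists_isApproxDelta μ
  have hδ := hz.isDeltaNet hZ (I := J)
  have := hZ.neBot_atTop (I := J)
  obtain ⟨C, hC0, hC⟩ := ω.eventually_le 1
  have hej : ∀ a, Tendsto (fun q : Zᵒᵈ × J => e q.2 * a) atTop (𝓝 a) := by
    intro a
    rw [← prod_atTop_atTop_eq]
    exact (he a).comp tendsto_snd
  set w : Zᵒᵈ × J → WeightedL1 A ω μ := fun q =>
    toWeightedL1 ω μ (tensorCc (z (OrderDual.ofDual q.1)) (e q.2)) with hw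
  -- The bound is only eventual: the density must first be supported where ω ≤ C.
  have hwb : ∀ᶠ q in atTop, ‖w q‖ ≤ C * K := by
    filter_upwards [hδ.eventually_eq_zero _ hC] with q hq
    refine (norm_toWeightedL1_tensorCc_le ω μ (hδ.nonneg q) (hδ.integral_eq_one q) (C := C)
      (fun r hr => by_contra fun h => hr (hq r h)) _).trans ?_
    gcongr
    exact hK _
  refine ⟨‖T.T‖ * (C * K), by positivity, fun D hD => ?_⟩
  -- As D acts on the left factor, T(D w)T(f)x = T(D(w * f))x, and w * f → f.
  have key : ∀ (f : C_c(G, A)) (x : X), Tendsto (fun q => T.T (D (w q))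
      (T.T (toWeightedL1 ω μ f) x)) atTop (𝓝 (T.T (D (toWeightedL1 ω μ f)) x)) := by
    intro f x
    have h := tendsto_beurlingMul_tensorCc ω μ α hα hδ (fun q => hK q.2) hej f
    have hc : Continuous fun u => T.T (D u) x :=
      (T.T.continuous.comp D.continuous).clm_apply continuous_const
    refine ((hc.tendsto _).comp h).congr fun q => ?_
    simp only [Function.comp_apply, hD, T.T_mul, mul_apply_eq_comp, hw]
  have hbound : ∀ᶠ q in atTop, ‖T.T (D (w q))‖ ≤ ‖T.T‖ * (C * K) * ‖D‖ := by
    filter_upwards [hwb] with q hq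
    calc ‖T.T (D (w q))‖ ≤ ‖T.T‖ * (‖D‖ * ‖w q‖) :=
          (T.T.le_opNorm _).trans (by gcongr; exact D.le_opNorm _)
      _ ≤ ‖T.T‖ * (‖D‖ * (C * K)) := by gcongr
      _ = ‖T.T‖ * (C * K) * ‖D‖ := by ring
  obtain ⟨S, hS, hSt⟩ := exists_clm_of_tendsto_on_dense_span hbound hT.dense_span_coe
    (by rintro _ ⟨f, x, rfl⟩; exact ⟨_, key f x⟩)
  refine ⟨S, hS, fun u x => ?_⟩
  have h : (ContinuousLinearMap.compL 𝕜 X X X S) ∘L T.T = T.T ∘L D :=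
    WeightedL1.ext_clm ω μ fun f => ContinuousLinearMap.ext fun x =>
      tendsto_nhds_unique (hSt _) (key f x)
  exact congrArg (fun S => S u x) h

/-- Reduces the algebraic relations for π and U to relations between the corresponding centralizers.
-/
theorem BeurlingRep.Nondegenerate.ext_clm {T : BeurlingRep α hα ω μ X}
    (hT : T.Nondegenerate) {S S' : X →L[𝕜] X} (h : ∀ u x, S (T.T u x) = S' (T.T u x)) : S = S' := by
  refine ContinuousLinearMap.ext_on hT ?_
  rintro _ ⟨u, x, rfl⟩
  exact h u x

/-- π(a) and U_s are the operators attached to the centralizers L_a and Λ_s; their algebraic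
properties and the continuity of U are inherited through the dense span of the vectors T(u)x. -/
theorem BeurlingRep.Nondegenerate.exists_covariantRep {T : BeurlingRep α hα ω μ X}
    (hT : T.Nondegenerate) {J : Type*} [Preorder J] [IsDirectedOrder J] [Nonempty J] {e : J → A}
    (he : IsLeftApproxIdentity e) (he_bdd : ∃ K : ℝ, ∀ j, ‖e j‖ ≤ K) :
    ∃ p : ContinuousCovariantRep α X, p.Nondegenerate ∧ p.BoundedByWeight ω ∧
      (∀ a u x, p.π a (T.T u x) = T.T (leftMulL1 𝕜 ω μ a u) x) ∧
      ∀ s u x, p.U s (T.T u x) = T.T (translateL1 ω μ α s u) x := by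
  obtain ⟨κ, hκ, H⟩ := hT.exists_operator he he_bdd
  choose π hπn hπ using fun a : A =>
    H (leftMulL1 𝕜 ω μ a) (leftMulL1_beurlingMul ω μ α hα a)
  choose U hUn hU using fun s : G =>
    H (translateL1 ω μ α s) (translateL1_beurlingMul ω μ α hα s)
  obtain ⟨C, hC⟩ := id hα
  have hC0 : 0 ≤ C := (norm_nonneg _).trans (hC 1)
  have hUb : ∀ s, ‖U s‖ ≤ κ * C * ω s := fun s => (hUn s).trans (by
    rw [mul_assoc]
    gcongr
    exact (norm_translateL1_le ω μ α s).trans (by gcongr; exact hC s))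
  let πL : A →ₗ[𝕜] (X →L[𝕜] X) :=
    { toFun := π
      map_add' := fun a b => hT.ext_clm fun u x => by
        simp only [add_apply, hπ, leftMulL1_add, map_add]
      map_smul' := fun c a => hT.ext_clm fun u x => by
        simp only [smul_apply, hπ, leftMulL1_smul, map_smul, RingHom.id_apply] }
  let p : ContinuousCovariantRep α X :=
    { π := πL.mkContinuous κ fun a =>
        (hπn a).trans (by gcongr; exact norm_leftMulL1_le ω μ a)
      U :=
        { toFun := U
          map_one' := hT.ext_clm fun u x => by
            rw [hU, translateL1_one]; rfl
          map_mul' := fun s t => hT.ext_clm fun u x => by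
            rw [mul_apply_eq_comp, hU, hU, hU, translateL1_mul]; rfl }
      π_mul := fun a b => hT.ext_clm fun u x => by
        change π (a * b) _ = π a (π b _)
        rw [hπ, hπ, hπ, leftMulL1_mul]; rfl
      U_continuous := fun x => by
        refine continuous_iff_continuousAt.2 fun r₀ => ?_
        obtain ⟨M, hM0, hM⟩ := ω.eventually_le r₀
        refine tendsto_apply_of_dense_span (S := U) (S₀ := U r₀) (κ := κ * C * M) ?_ hT ?_ x
        · filter_upwards [hM] with r hr
          exact (hUb r).trans (by gcongr)
        · rintro _ ⟨u, x, rfl⟩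
          simp only [hU]
          have hc : Continuous fun v => T.T v x := T.T.continuous.clm_apply continuous_const
          exact (hc.comp (continuous_translateL1 ω μ α hα u)).continuousAt
      covariant := fun s a => by
        -- Covariance is obtained first without inverses, then multiplied on the right by U_{s⁻¹}.
        have h1 : π (α s a) * U s = U s * π a := hT.ext_clm fun u x => by
          rw [mul_apply_eq_comp, mul_apply_eq_comp, hU, hπ, hπ, hU]
          exact congrArg (fun S => T.T (S u) x) (translateL1_comp_leftMulL1 ω μ α s a).symm
        have h2 : U s * U s⁻¹ = 1 := hT.ext_clm fun u x => by
          rw [mul_apply_eq_comp, hU, hU, ← ContinuousLinearMap.comp_apply (translateL1 ω μ α s),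
            ← translateL1_mul, mul_inv_cancel, translateL1_one]
          rfl
        change π (α s a) = U s * π a * U s⁻¹
        rw [← h1, mul_assoc, h2, mul_one] }
  refine ⟨p, ?_, ⟨κ * C, by positivity, hUb⟩, hπ, hU⟩
  obtain ⟨K, hK⟩ := he_bdd
  refine dense_span_of_subset_closure hT ?_
  rintro _ ⟨u, x, rfl⟩
  have hc : Continuous fun v => T.T v x := T.T.continuous.clm_apply continuous_const
  -- Non-degeneracy of π: π(e_j)T(u)x = T(e_j u)x → T(u)x.
  refine mem_closure_of_tendsto ((hc.tendsto _).comp (tendsto_leftMulL1 (𝕜 := 𝕜) ω μ hK he u))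
    (Eventually.of_forall fun j => Submodule.subset_span ⟨e j, T.T u x, hπ _ _ _⟩)

/-! The two constructions are mutually inverse. -/

variable [NormedSpace ℝ X] [IsScalarTower ℝ 𝕜 X]

/-- The intertwining relations fix π and U on the vectors T(u)x, which span a dense subspace. -/
theorem ContinuousCovariantRep.integratedForm_injective {p p' : ContinuousCovariantRep α X}
    (hn : p.Nondegenerate) (hp : p.BoundedByWeight ω) (hp' : p'.BoundedByWeight ω)
    (h : p.integratedForm hα ω μ hp = p'.integratedForm hα ω μ hp') : p = p' := by
  have hT := hn.integratedForm hα ω μ hp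
  have h' : p.integralL1 ω μ hp = p'.integralL1 ω μ hp' := congrArg BeurlingRep.T h
  ext1
  · refine ContinuousLinearMap.ext fun a => hT.ext_clm fun u x => ?_
    refine (p.π_integralL1 ω μ hp a u x).trans ?_
    change _ = p'.π a (p.integralL1 ω μ hp u x)
    rw [h', p'.π_integralL1]
  · refine MonoidHom.ext fun s => hT.ext_clm fun u x => ?_
    refine (p.U_integralL1 ω μ hp s u x).trans ?_
    change _ = p'.U s (p.integralL1 ω μ hp u x)
    rw [h', p'.U_integralL1]

/-- On a vector T(g)x the integral equals T(f * g)x = T(f)T(g)x, and such vectors have dense span.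
-/
theorem BeurlingRep.Nondegenerate.integratedForm_eq {T : BeurlingRep α hα ω μ X}
    (hT : T.Nondegenerate) {p : ContinuousCovariantRep α X} (hp : p.BoundedByWeight ω)
    (hπ : ∀ a u x, p.π a (T.T u x) = T.T (leftMulL1 𝕜 ω μ a u) x)
    (hU : ∀ s u x, p.U s (T.T u x) = T.T (translateL1 ω μ α s u) x) :
    p.integratedForm hα ω μ hp = T := by
  refine BeurlingRep.ext (WeightedL1.ext_clm ω μ fun f => ContinuousLinearMap.ext_on
    hT.dense_span_coe ?_)
  rintro _ ⟨g, x, rfl⟩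
  rw [p.integratedForm_coe, ← apply_beurlingMul_eq_integral p hα ω μ hπ hU, T.T_mul,
    mul_apply_eq_comp]

variable (hα ω μ X) in
/-- The bijection between non-degenerate covariant representations and non-degenerate
representations of the Beurling algebra. -/
def integratedFormEquiv {J : Type*} [Preorder J] [IsDirectedOrder J] [Nonempty J] {e : J → A}
    (he : IsLeftApproxIdentity e) (he_bdd : ∃ K : ℝ, ∀ j, ‖e j‖ ≤ K) :
    {p : ContinuousCovariantRep α X // p.Nondegenerate ∧ p.BoundedByWeight ω} ≃
      {T : BeurlingRep α hα ω μ X // T.Nondegenerate} :=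
  Equiv.ofBijective
    (fun p => ⟨p.1.integratedForm hα ω μ p.2.2, p.2.1.integratedForm hα ω μ p.2.2⟩) <| by
    refine ⟨fun p p' h => Subtype.ext ?_, fun T => ?_⟩
    · exact ContinuousCovariantRep.integratedForm_injective p.2.1 p.2.2 p'.2.2
        (congrArg Subtype.val h)
    · obtain ⟨p, hn, hb, hπ, hU⟩ := T.2.exists_covariantRep he he_bdd
      exact ⟨⟨p, hn, hb⟩, Subtype.ext (T.2.integratedForm_eq hb hπ hU)⟩

/-! Norm bounds. -/

theorem bddAbove_weight_of_mem {Z : Set (Set G)} (ω : GroupWeight G) (hZ : IsBoundedNhdsBase Z)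
    (V : Z) : BddAbove (Set.range fun r : (V : Set G) => (ω r : ℝ)) := by
  obtain ⟨K, hK, hKZ⟩ := hZ.exists_compact
  obtain ⟨C, hC⟩ := ω.exists_bound_of_isCompact hK
  refine ⟨C, ?_⟩
  rintro _ ⟨r, rfl⟩
  exact_mod_cast hC r (hKZ V V.2 r.2)

theorem le_infSupWeight_mul {Z : Set (Set G)} (ω : GroupWeight G) (hZ : IsBoundedNhdsBase Z)
    {x c : ℝ} (hc : 0 ≤ c) (h : ∀ V : Z, x ≤ (⨆ r : (V : Set G), (ω r : ℝ)) * c) :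
    x ≤ infSupWeight ω Z * c := by
  have := hZ.nonempty
  rw [infSupWeight, Real.iInf_mul_of_nonneg hc]
  exact le_ciInf h

/-- If the densities `z_q` eventually live in `V`, limits of `T(z_q(s⁻¹ ·) ⊗ b_q)x` are controlled
by the supremum of `ω` on `V`. -/
theorem BeurlingRep.norm_le_of_tendsto (T : BeurlingRep α hα ω μ X) {Z : Set (Set G)}
    (hZ : IsBoundedNhdsBase Z) (V : Z) {Q : Type*} {l : Filter Q} [l.NeBot] {z : Q → C_c(G, ℝ)}
    (hz : IsDeltaNet μ l z) {s : G} {D : ℝ} (hD : ∀ r, (ω (s * r) : ℝ) ≤ D * ω r) (hD0 : 0 ≤ D)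
    {b : Q → A} {M : ℝ} (hb : Tendsto (fun q => ‖b q‖) l (𝓝 M) ∨ ∀ q, ‖b q‖ ≤ M) {x y : X}
    (h : Tendsto (fun q => T.T (toWeightedL1 ω μ (tensorCc (leftTranslate s (z q)) (b q))) x) l
      (𝓝 y)) :
    ‖y‖ ≤ ‖T.T‖ * (D * (⨆ r : (V : Set G), (ω r : ℝ)) * M) * ‖x‖ := by
  set B := ⨆ r : (V : Set G), (ω r : ℝ) with hB
  have hB0 : 0 ≤ B := Real.iSup_nonneg fun r => NNReal.coe_nonneg _
  have hle : ∀ᶠ q in l, ‖T.T (toWeightedL1 ω μ (tensorCc (leftTranslate s (z q)) (b q))) x‖ ≤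
      ‖T.T‖ * (D * B * ‖b q‖) * ‖x‖ := by
    filter_upwards [hz.eventually_eq_zero _ (hZ.mem_nhds V V.2)] with q hq
    refine (ContinuousLinearMap.le_opNorm _ _).trans ?_
    gcongr
    refine (T.T.le_opNorm _).trans ?_
    gcongr
    refine norm_toWeightedL1_tensorCc_le ω μ (z := leftTranslate s (z q))
      (fun r => hz.nonneg q _)
      ((integral_mul_left_eq_self (z q) s⁻¹).trans (hz.integral_eq_one q)) (fun r hr => ?_) _
    have hrV : s⁻¹ * r ∈ (V : Set G) := by_contra fun h => hr (hq _ h)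
    have h1 := hD (s⁻¹ * r)
    rw [mul_inv_cancel_left] at h1
    refine h1.trans (by gcongr; exact le_ciSup (bddAbove_weight_of_mem ω hZ V) ⟨_, hrV⟩)
  -- Convergence of ‖b_q‖ to M serves the bound on π, the uniform bound by M the one on U.
  obtain hb | hb := hb
  · exact le_of_tendsto_of_tendsto h.norm (((hb.const_mul _).const_mul _).mul_const _) hle
  · refine le_of_tendsto h.norm (hle.mono fun q hq => hq.trans ?_)
    gcongr
    exact hb q

end Disintegration

end
noncomputable section

/-! ### Limit formulas and norm bounds -/

section Limits

variable {𝕜 : Type*} [RCLike 𝕜]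
  {G : Type*} [Group G] [TopologicalSpace G] [IsTopologicalGroup G] [T2Space G]
  [LocallyCompactSpace G] [MeasurableSpace G] [BorelSpace G]
  {A : Type*} [NonUnitalNormedRing A] [NormedSpace 𝕜 A] [IsScalarTower 𝕜 A A]
  [SMulCommClass 𝕜 A A] [CompleteSpace A] [NormedSpace ℝ A] [IsScalarTower ℝ 𝕜 A]
  {X : Type*} [NormedAddCommGroup X] [NormedSpace 𝕜 X] [CompleteSpace X]
  [NormedSpace ℝ X] [IsScalarTower ℝ 𝕜 X]
  {α : BanachAlgebraAction 𝕜 G A} (hα : α.UniformlyBounded) {ω : GroupWeight G} (μ : Measure G)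
  [μ.IsHaarMeasure] {p : ContinuousCovariantRep α X}

theorem IsLeftApproxIdentity.tendsto_snd {A I P : Type*} [NonUnitalNormedRing A] [Preorder I]
    [Preorder P] {u : I → A} (hu : IsLeftApproxIdentity u) (a : A) :
    Tendsto (fun q : P × I => u q.2 * a) atTop (𝓝 a) := by
  rw [← prod_atTop_atTop_eq]
  exact (hu a).comp Filter.tendsto_snd

theorem ContinuousCovariantRep.Nondegenerate.tendsto_tensorCc_mul (hn : p.Nondegenerate)
    (hp : p.BoundedByWeight ω) {Z : Set (Set G)} (hZ : IsBoundedNhdsBase Z) {z : Z → C_c(G, ℝ)}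
    (hz : IsApproxDelta μ Z z) {I : Type*} [Preorder I] [Nonempty I] {u : I → A}
    (hu : IsLeftApproxIdentity u) {K : ℝ} (hK : ∀ i, ‖u i‖ ≤ K) (a : A) (x : X) :
    Tendsto (fun q : Zᵒᵈ × I => (p.integratedForm hα ω μ hp).T (toWeightedL1 ω μ
      (tensorCc (leftTranslate 1 (z (OrderDual.ofDual q.1))) (a * u q.2))) x)
      atTop (𝓝 (p.π a x)) := by
  refine p.tendsto_integratedForm_tensorCc hα ω μ hp 1 (hz.isDeltaNet hZ)
    (b := fun q : Zᵒᵈ × I => a * u q.2) (κ := ‖a‖ * K)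
    (fun q => (norm_mul_le _ _).trans (by gcongr; exact hK _)) ?_
  refine (((p.π a).continuous.tendsto _).comp
    (hn.tendsto_π (fun q : Zᵒᵈ × I => hK q.2) hu.tendsto_snd x)).congr fun q => ?_
  simp [p.π_mul]

theorem ContinuousCovariantRep.Nondegenerate.tendsto_tensorCc_leftTranslate (hn : p.Nondegenerate)
    (hp : p.BoundedByWeight ω) {Z : Set (Set G)} (hZ : IsBoundedNhdsBase Z) {z : Z → C_c(G, ℝ)}
    (hz : IsApproxDelta μ Z z) {I : Type*} [Preorder I] [Nonempty I] {u : I → A}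
    (hu : IsLeftApproxIdentity u) {K : ℝ} (hK : ∀ i, ‖u i‖ ≤ K) (s : G) (x : X) :
    Tendsto (fun q : Zᵒᵈ × I => (p.integratedForm hα ω μ hp).T (toWeightedL1 ω μ
      (tensorCc (leftTranslate s (z (OrderDual.ofDual q.1))) (u q.2))) x)
      atTop (𝓝 (p.U s x)) :=
  p.tendsto_integratedForm_tensorCc hα ω μ hp s (hz.isDeltaNet hZ)
    (b := fun q : Zᵒᵈ × I => u q.2) (fun q => hK q.2)
    (hn.tendsto_π (fun q : Zᵒᵈ × I => hK q.2) hu.tendsto_snd _)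

/-- The limit is taken along z_V ⊗ (a e_j). Since a e_j → a, the norms tend to ‖a‖, so the bound K
on the approximate identity does not enter the estimate. -/
theorem ContinuousCovariantRep.Nondegenerate.norm_π_le (hn : p.Nondegenerate)
    (hp : p.BoundedByWeight ω) {Z : Set (Set G)} (hZ : IsBoundedNhdsBase Z)
    {J : Type*} [Preorder J] [IsDirectedOrder J] [Nonempty J] {e : J → A}
    (he_left : IsLeftApproxIdentity e) (he_right : IsRightApproxIdentity e)
    {K : ℝ} (hK : ∀ j, ‖e j‖ ≤ K) :
    ‖p.π‖ ≤ infSupWeight ω Z * ‖(p.integratedForm hα ω μ hp).T‖ := by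
  obtain ⟨z, hz⟩ := hZ.exists_isApproxDelta μ
  have := hZ.neBot_atTop (I := J)
  refine le_infSupWeight_mul ω hZ (by positivity) fun V => ?_
  have hB0 : 0 ≤ ⨆ r : (V : Set G), (ω r : ℝ) := Real.iSup_nonneg fun r => NNReal.coe_nonneg _
  refine ContinuousLinearMap.opNorm_le_bound _ (by positivity) fun a =>
    ContinuousLinearMap.opNorm_le_bound _ (by positivity) fun x => ?_
  have hb : Tendsto (fun q : Zᵒᵈ × J => ‖a * e q.2‖) atTop (𝓝 ‖a‖) := by
    rw [← prod_atTop_atTop_eq]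
    exact ((he_right a).comp Filter.tendsto_snd).norm
  -- At s = e the factor D = 1 is used instead of ω(e), which may exceed 1.
  refine (BeurlingRep.norm_le_of_tendsto _ hZ V (hz.isDeltaNet hZ) (s := 1) (D := 1) (by simp)
    zero_le_one (.inl hb) (hn.tendsto_tensorCc_mul hα μ hp hZ hz he_left hK a x)).trans_eq ?_
  ring

theorem ContinuousCovariantRep.Nondegenerate.norm_U_le (hn : p.Nondegenerate)
    (hp : p.BoundedByWeight ω) {Z : Set (Set G)} (hZ : IsBoundedNhdsBase Z)
    {I : Type*} [Preorder I] [IsDirectedOrder I] [Nonempty I] {u : I → A}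
    (hu : IsLeftApproxIdentity u) {M : ℝ} (hM : ∀ i, ‖u i‖ ≤ M) (s : G) :
    ‖p.U s‖ ≤ M * infSupWeight ω Z * ‖(p.integratedForm hα ω μ hp).T‖ * ω s := by
  obtain ⟨z, hz⟩ := hZ.exists_isApproxDelta μ
  have := hZ.neBot_atTop (I := I)
  have hM0 : 0 ≤ M := (norm_nonneg _).trans (hM (Classical.arbitrary I))
  suffices h : ‖p.U s‖ ≤
      infSupWeight ω Z * (M * ‖(p.integratedForm hα ω μ hp).T‖ * ω s) from
    h.trans_eq (by ring)
  refine le_infSupWeight_mul ω hZ (by positivity) fun V => ?_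
  have hB0 : 0 ≤ ⨆ r : (V : Set G), (ω r : ℝ) := Real.iSup_nonneg fun r => NNReal.coe_nonneg _
  refine ContinuousLinearMap.opNorm_le_bound _ (by positivity) fun x => ?_
  refine (BeurlingRep.norm_le_of_tendsto _ hZ V (hz.isDeltaNet hZ) (s := s) (D := ω s)
    (fun r => by exact_mod_cast ω.submul' s r) (NNReal.coe_nonneg _)
    (b := fun q : Zᵒᵈ × I => u q.2) (.inr fun q => hM q.2)
    (hn.tendsto_tensorCc_leftTranslate hα μ hp hZ hz hu hM s x)).trans_eq ?_
  ring

end Limits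

end

/-! ### The bijection with its limit formulas and norm bounds -/

theorem mainTheorem1
    {𝕜 : Type*} [RCLike 𝕜]
    {G : Type*} [Group G] [TopologicalSpace G] [IsTopologicalGroup G] [T2Space G]
    [LocallyCompactSpace G] [MeasurableSpace G] [BorelSpace G]
    {A : Type*} [NonUnitalNormedRing A] [NormedSpace 𝕜 A] [IsScalarTower 𝕜 A A]
    [SMulCommClass 𝕜 A A] [CompleteSpace A] [NormedSpace ℝ A] [IsScalarTower ℝ 𝕜 A]
    {X : Type*} [NormedAddCommGroup X] [NormedSpace 𝕜 X] [CompleteSpace X]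
    [NormedSpace ℝ X] [IsScalarTower ℝ 𝕜 X]
    (μ : Measure G) [μ.IsHaarMeasure] [μ.Regular]
    (α : BanachAlgebraAction 𝕜 G A) (hα : α.UniformlyBounded) (ω : GroupWeight G)
    {J : Type*} [Preorder J] [IsDirectedOrder J] [Nonempty J] (e : J → A)
    (he_left : IsLeftApproxIdentity e) (he_right : IsRightApproxIdentity e)
    (he_bdd : ∃ K : ℝ, ∀ j, ‖e j‖ ≤ K) :
    ∃ Φ : {p : ContinuousCovariantRep α X // p.Nondegenerate ∧ p.BoundedByWeight ω} ≃
        {T : BeurlingRep α hα ω μ X // T.Nondegenerate},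
      -- the map `(π, U) ↦ T`
      (∀ p (f : C_c(G, A)) (x : X),
        (Φ p).1.T (toWeightedL1 ω μ f) x = ∫ r, p.1.π (f r) (p.1.U r x) ∂μ) ∧
      -- the inverse map `T ↦ (π, U)`
      (∀ T (Z : Set (Set G)) (_ : IsBoundedNhdsBase Z)
        (z : Z → C_c(G, ℝ)) (_ : IsApproxDelta μ Z z)
        {I : Type*} [Preorder I] [IsDirectedOrder I] [Nonempty I] (u : I → A)
        (_ : IsLeftApproxIdentity u) (_ : ∃ K : ℝ, ∀ i, ‖u i‖ ≤ K),
        (∀ (a : A) (x : X),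
          Tendsto (fun q : Zᵒᵈ × I =>
              T.1.T (toWeightedL1 ω μ (tensorCc (z (OrderDual.ofDual q.1)) (a * u q.2))) x)
            atTop (𝓝 ((Φ.symm T).1.π a x))) ∧
        (∀ (s : G) (x : X),
          Tendsto (fun q : Zᵒᵈ × I =>
              T.1.T (toWeightedL1 ω μ
                (tensorCc (leftTranslate s (z (OrderDual.ofDual q.1))) (u q.2))) x)
            atTop (𝓝 ((Φ.symm T).1.U s x)))) ∧
      -- the norm bounds
      (∀ p (C : ℝ), 0 ≤ C → (∀ r : G, ‖p.1.U r‖ ≤ C * ω r) →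
        ‖(Φ p).1.T‖ ≤ C * ‖p.1.π‖) ∧
      (∀ T (Z : Set (Set G)), IsBoundedNhdsBase Z →
        ‖(Φ.symm T).1.π‖ ≤ infSupWeight ω Z * ‖T.1.T‖) ∧
      (∀ T (Z : Set (Set G)), IsBoundedNhdsBase Z →
        ∀ {I : Type*} [Preorder I] [IsDirectedOrder I] [Nonempty I] (u : I → A) (M : ℝ),
          IsLeftApproxIdentity u → (∀ i, ‖u i‖ ≤ M) →
          ∀ s : G, ‖(Φ.symm T).1.U s‖ ≤ M * infSupWeight ω Z * ‖T.1.T‖ * ω s) := by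
  set Φ := integratedFormEquiv X hα ω μ he_left he_bdd
  have hn : ∀ T, (Φ.symm T).1.Nondegenerate := fun T => (Φ.symm T).2.1
  have hp : ∀ T, (Φ.symm T).1.BoundedByWeight ω := fun T => (Φ.symm T).2.2
  -- Each T is an integrated form, so the limits are computed for integrated forms. They are
  -- identified with fixed operators π_a and U_s, hence do not depend on the choice of Z, z or u.
  have hsymm : ∀ T, T.1 = (Φ.symm T).1.integratedForm hα ω μ (hp T) := fun T =>
    congrArg Subtype.val (Φ.apply_symm_apply T).symm
  refine ⟨Φ, fun p f x => p.1.integratedForm_coe hα ω μ p.2.2 f x, ?_,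
    fun p C hC0 hC => p.1.norm_integralL1_le ω μ p.2.2 hC0 hC, ?_, ?_⟩
  · intro T Z hZ z hz I _ _ _ u hu hub
    obtain ⟨K, hK⟩ := hub
    rw [hsymm T]
    refine ⟨fun a x => ?_, fun s x =>
      (hn T).tendsto_tensorCc_leftTranslate hα μ (hp T) hZ hz hu hK s x⟩
    simpa only [leftTranslate_one] using
      (hn T).tendsto_tensorCc_mul hα μ (hp T) hZ hz hu hK a x
  · intro T Z hZ
    obtain ⟨K, hK⟩ := he_bdd
    rw [hsymm T]
    exact (hn T).norm_π_le hα μ (hp T) hZ he_left he_right hK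
  · intro T Z hZ I _ _ _ u M hu hM s
    rw [hsymm T]
    exact (hn T).norm_U_le hα μ (hp T) hZ hu hM s
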